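/- **Model.** A $K$-armed bandit instance $\nu$ gives each arm $a\in[K]$ a reward law on $[0,1]$ with mean $\mu_a$; put $\mu^\star=\max_a\mu_a$. In round $t\in[T]$ the learner pulls an arm $A_t$ and observes a reward drawn from the law of $A_t$, independently of the past given $A_t$. The expected pseudo-regret is $\mathbb E_\nu[\mathrm{Reg}_T]=\mathbb E_\nu\sum_{t=1}^T(\mu^\star-\mu_{A_t})$. A static-grid algorithm with $B$ batches fixes boundaries $0=\tau_0<\tau_1<\dots<\tau_B=T$ in advance, and carries a persistent memory $M_t=\phi_t(M_{t-1},U,A_t,R_t)$, where $U$ is a seed independent of the rewards. In batch $b$ it plays $A_t=\rho_{b,t}(M_{\tau_{b-1}},U)$ for $\tau_{b-1}<t\le\tau_b$. The time index is public, and all maps are measurable. The algorithm uses $W$ bits if the memory has at most $2^W$ possible values. $\log$ is the natural logarithm. **Algorithm** (parameters $K\ge2$, block size $S\in[K]$, horizon $T$, $\delta\in(0,1)$). Let $c(s)=\sqrt{\log(2/\delta)/(2s)}$, $t_0=1$, $t_i=\lceil\sqrt{t_{i-1}T/(10K)}\,\rceil$ for $i\ge1$, $L=\lfloor\log_2\log_2(T/(10K))\rfloor$,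 $J=\lceil (K-1)/S\rceil$. The first incumbent is arm $1$. For $i=1,\dots,L$: 1. (One batch.) Let $a_{\mathrm{init}}$ be the current incumbent. Pull it $t_i$ times and store the empirical mean of these rewards as the incumbent summary. 2. Partition $[K]\setminus\{a_{\mathrm{init}}\}$ into ordered blocks $C_1,\dots,C_J$ of size at most $S$; the sizes are fixed in advance. For $j=1,\dots,J$, freeze the incumbent and its summary as $(\bar a,\bar\mu)$, declare all arms of $C_j$ active, and do the following. - For $k=1,\dots,i$ (one batch each, with $t_k$ pulls reserved for each arm of $C_j$): for each $a\in C_j$ that is active at the start of the batch, pull $a$ for $t_k$ rounds, let $\widehat\mu_k(a)$ be the empirical mean of these rewards, and deactivate $a$ at the end of the batch if $\widehat\mu_k(a)<\bar\mu-2c(t_k)$. For each inactive $a\in C_j$, pull $\bar a$ for $t_k$ rounds instead, ignoring the rewards. - If some arm of $C_j$ is still active after level $k=i$, let $\tilde a$ be an active arm of $C_j$ with the largest $\widehat\mu_i$. If $\widehat\mu_i(\tilde a)\ge\bar\mu+2c(t_i)$, make $\tilde a$ the incumbent with summary $\widehat\mu_i(\tilde a)$. All remaining rounds form one final batch, in which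 the final incumbent is pulled. In the version with precision $T^{-p}$ ($p\ge1$ an integer), every reward is rounded down to a multiple of $T^{-p}$ before it enters an empirical mean, and the memory holds $a_{\mathrm{init}}$, the incumbent, and, for the incumbent and for each of at most $S$ block positions, a sum of rounded rewards, with an activity flag for each position; in the exact version the rewards are not rounded. **Theorem.** There are universal constants $c,C_1,C_2,C_3>0$ such that for every $K\ge2$, every $S\in[K]$, every horizon $T\ge cK$, every choice of the partitions and orders of the blocks (depending only on $i$ and $a_{\mathrm{init}}$, with sizes depending only on $i$) and every tie-breaking rule (depending only on $i$, $j$, $a_{\mathrm{init}}$ and the set of tied positions), the algorithm run with $\delta=T^{-4}$ is, both in the exact version and in the version with precision $T^{-p}$ for every integer $p\ge1$, a static-grid algorithm for the horizon $T$ that uses at most $C_2\frac KS(\log\log T)^2$ batches and satisfies $$\sup_\nu\mathbb E_\nu[\mathrm{Reg}_T]\le C_3\sqrt{KT\log T}\,(\log\log T)^2,$$ where the supremum is over all $K$-armed instances with rewards in $[0,1]$. Moreover, the version with precision $T^{-p}$ uses at most $C_1\,p\,S\log T$ bits of persistent memory. -/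

import Mathlib

open MeasureTheory

noncomputable section

/-! ### Stochastic bandits -/

/-- A `K`-armed stochastic bandit instance with rewards in `[0,1]`. -/
structure BanditInstance (K : ℕ) where
  law : Fin K → Measure ℝ
  isProb : ∀ a, IsProbabilityMeasure (law a)
  supp : ∀ a, ∀ᵐ x ∂(law a), x ∈ Set.Icc (0 : ℝ) 1

namespace BanditInstance

variable {K : ℕ}

instance (ν : BanditInstance K) (a : Fin K) : IsProbabilityMeasure (ν.law a) := ν.isProb a

/-- The mean reward of arm `a`. -/
def mean (ν : BanditInstance K) (a : Fin K) : ℝ := ∫ x, x ∂(ν.law a)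

/-- The largest mean reward. -/
def best (ν : BanditInstance K) : ℝ := ⨆ a, ν.mean a

/-- The law of the table of rewards: entry `(t, a)` is the reward that a pull of arm `a` in round
`t` (rounds are numbered from `0`) yields; all entries are independent, entry `(t, a)` has
law `ν.law a`. A learner sees only the entry of the arm that it pulls. -/
def tableLaw (ν : BanditInstance K) : Measure (ℕ → Fin K → ℝ) :=
  Measure.infinitePi fun _ : ℕ => Measure.pi ν.law

end BanditInstance

/-! ### Batched algorithms with persistent memory -/

/-- The data of a static-grid batched algorithm with persistent memory. The time index and the grid
are public and are not part of the memory.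

Rounds and batches are numbered from `0`: batch `b` consists of the rounds `t` with
`grid b ≤ t < grid (b + 1)`, and `M_t` is the memory before round `t`. The actions of batch `b` are
`A_t = plan b t M_{grid b} U`, and the memory evolves by `M_{t+1} = update t M_t U A_t R_t`. -/
structure BatchedAlg (K : ℕ) where
  Seed : Type
  seedMeas : MeasurableSpace Seed
  seedLaw : Measure Seed
  Mem : Type
  memMeas : MeasurableSpace Mem
  /-- the fixed initial memory -/
  init : Mem
  /-- the number of batches -/
  batches : ℕ
  grid : ℕ → ℕ
  plan : ℕ → ℕ → Mem → Seed → Fin K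
  update : ℕ → Mem → Seed → Fin K → ℝ → Mem

namespace BatchedAlg

variable {K : ℕ}

instance (A : BatchedAlg K) : MeasurableSpace A.Seed := A.seedMeas

instance (A : BatchedAlg K) : MeasurableSpace A.Mem := A.memMeas

/-- The data form a static-grid algorithm for the horizon `T`: the grid is
`0 = t_0 < t_1 < ⋯ < t_B = T`, the seed is random with a probability law, all maps are
measurable. -/
structure IsStaticGrid (A : BatchedAlg K) (T : ℕ) : Prop where
  seed_prob : IsProbabilityMeasure A.seedLaw
  grid_zero : A.grid 0 = 0
  grid_lt : ∀ b < A.batches, A.grid b < A.grid (b + 1)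
  grid_last : A.grid A.batches = T
  measurable_plan : ∀ b t, Measurable fun z : A.Mem × A.Seed => A.plan b t z.1 z.2
  measurable_update : ∀ t, Measurable fun z : A.Mem × A.Seed × Fin K × ℝ =>
    A.update t z.1 z.2.1 z.2.2.1 z.2.2.2

/-- The algorithm has at most `2 ^ W` persistent memory states. -/
def UsesBits (A : BatchedAlg K) (W : ℕ) : Prop := Finite A.Mem ∧ Nat.card A.Mem ≤ 2 ^ W

/-- The batch that round `t` belongs to: the number of internal boundaries that are `≤ t`. -/
def batchAt (A : BatchedAlg K) (t : ℕ) : ℕ :=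
  ((Finset.Ico 1 A.batches).filter fun b => A.grid b ≤ t).card

/-- The pair (memory at the last batch boundary `≤ t`, memory `M_t`), when the seed is `u` and the
table of rewards is `x`. -/
def run (A : BatchedAlg K) (u : A.Seed) (x : ℕ → Fin K → ℝ) : ℕ → A.Mem × A.Mem
  | 0 => (A.init, A.init)
  | t + 1 =>
    let s := A.run u x t
    let a := A.plan (A.batchAt t) t s.1 u
    let m := A.update t s.2 u a (x t a)
    (if t + 1 ∈ (Finset.range (A.batches + 1)).image A.grid then m else s.1, m)

/-- The arm pulled in round `t`. -/
def action (A : BatchedAlg K) (u : A.Seed) (x : ℕ → Fin K → ℝ) (t : ℕ) : Fin K :=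
  A.plan (A.batchAt t) t (A.run u x t).1 u

/-- The pseudo-regret over the rounds `0, …, T - 1`. -/
def regret (A : BatchedAlg K) (T : ℕ) (ν : BanditInstance K)
    (ω : A.Seed × (ℕ → Fin K → ℝ)) : ℝ :=
  ∑ t ∈ Finset.range T, (ν.best - ν.mean (A.action ω.1 ω.2 t))

/-- The joint law of the seed and the table of rewards. -/
def jointLaw (A : BatchedAlg K) (ν : BanditInstance K) : Measure (A.Seed × (ℕ → Fin K → ℝ)) :=
  A.seedLaw.prod ν.tableLaw

/-- The expected pseudo-regret over `T` rounds exists and is at most `r` on every instance. -/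
def WorstCaseRegretLE (A : BatchedAlg K) (T : ℕ) (r : ℝ) : Prop :=
  ∀ ν : BanditInstance K,
    Integrable (A.regret T ν) (A.jointLaw ν) ∧ ∫ ω, A.regret T ν ω ∂(A.jointLaw ν) ≤ r

/-- The data form a static-grid algorithm for the horizon `T`, with at most `B` batches and
worst-case expected pseudo-regret at most `r`. -/
structure Achieves (A : BatchedAlg K) (T : ℕ) (B r : ℝ) : Prop where
  static_grid : A.IsStaticGrid T
  batches_le : (A.batches : ℝ) ≤ B
  regret_le : A.WorstCaseRegretLE T r

end BatchedAlg

/-! ### Stored sums of rewards -/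

/-- A register holding a sum of rewards; `val` is the real number that it stands for. -/
structure Register where
  Carrier : Type
  meas : MeasurableSpace Carrier
  zero : Carrier
  add : Carrier → ℝ → Carrier
  val : Carrier → ℝ

instance (V : Register) : MeasurableSpace V.Carrier := V.meas

/-- The exact (infinite precision) register. -/
def Register.exact : Register where
  Carrier := ℝ
  meas := inferInstance
  zero := 0
  add v x := v + x
  val v := v

/-- The finite precision register: rewards in `[0,1]` are rounded down to multiples of `T ^ (-p)`,
and a sum of at most `T` rounded rewards is held exactly, as the integer multiple of `T ^ (-p)`
that it is, in `{0, …, T ^ (p + 1)}`. -/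
def Register.rounded (T p : ℕ) : Register where
  Carrier := Fin (T ^ (p + 1) + 1)
  meas := ⊤
  zero := 0
  add v x := ⟨min (v.val + min ⌊(T : ℝ) ^ p * x⌋₊ (T ^ p)) (T ^ (p + 1)),
    Nat.lt_succ_of_le (min_le_right _ _)⟩
  val v := (v.val : ℝ) / (T : ℝ) ^ p

/-! ### The block-scan algorithm -/

namespace BlockScan

/-- The lengths `t_0 = 1`, `t_i = ⌈√(t_{i-1} T / (10 K))⌉`. -/
def len (K T : ℕ) : ℕ → ℕ
  | 0 => 1
  | i + 1 => ⌈√((len K T i : ℝ) * ((T : ℝ) / (10 * K)))⌉₊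

/-- The number `L = ⌊log₂ log₂ (T / (10 K))⌋` of outer iterations. -/
def numOuter (K T : ℕ) : ℕ := ⌊Real.logb 2 (Real.logb 2 ((T : ℝ) / (10 * K)))⌋₊

/-- The number `J = ⌈(K - 1) / S⌉` of blocks. -/
def numBlocks (K S : ℕ) : ℕ := ⌈((K : ℝ) - 1) / S⌉₊

/-- The confidence radius `c(s) = √(log (2 / δ) / (2 s))`. -/
def radius (δ : ℝ) (s : ℕ) : ℝ := √(Real.log (2 / δ) / (2 * s))

/-- The number of rounds before the final batch. -/
def mainRounds (K T : ℕ) : ℕ :=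
  ∑ i ∈ Finset.Icc 1 (numOuter K T), (len K T i + (K - 1) * ∑ k ∈ Finset.Icc 1 i, len K T k)

/-- The choices that the algorithm leaves open: how `[K] \ {a_init}` is partitioned into ordered
blocks, and which maximizer is taken in case of ties.

In outer iteration `i` with initial incumbent `a`, the arms other than `a` are listed as
`order i a 0, …, order i a (K - 2)`, and block `j` (blocks are numbered from `0`) holds the entries
with positions in `[cut i j, cut i (j + 1))`, at most `S` of them; entry `cut i j + q` is called the
`q`-th arm of the block. The sizes do not depend on `a`, so the layout is fixed in advance. -/
structure Choices (K S : ℕ) where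
  order : ℕ → Fin K → ℕ → Fin K
  order_bij : ∀ i a, Set.BijOn (order i a) (Set.Iio (K - 1)) {a}ᶜ
  cut : ℕ → ℕ → ℕ
  cut_zero : ∀ i, cut i 0 = 0
  cut_last : ∀ i, cut i (numBlocks K S) = K - 1
  cut_mono : ∀ i, Monotone (cut i)
  cut_size : ∀ i j, cut i (j + 1) ≤ cut i j + S
  tie : ℕ → ℕ → Fin K → Finset (Fin S) → Fin S
  tie_mem : ∀ i j a s, s.Nonempty → tie i j a s ∈ s

/-- The batches: the incumbent refresh of outer iteration `i ≥ 1`, the comparison slot at level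
`k ≥ 1` of block `j` in outer iteration `i`, and the final exploitation batch. -/
inductive Batch where
  | refresh (i : ℕ)
  | slot (i j k : ℕ)
  | final

/-- The batches in their order of execution. -/
def schedule (K S T : ℕ) : List Batch :=
  ((List.range (numOuter K T)).flatMap fun i =>
    Batch.refresh (i + 1) :: (List.range (numBlocks K S)).flatMap fun j =>
      (List.range (i + 1)).map fun k => Batch.slot (i + 1) j (k + 1)) ++ [Batch.final]

/-- The memory of the algorithm: the initial incumbent of the current outer iteration, the current
incumbent and the sum of the rewards behind its stored summary, and for each position of the current
block a flag and the sum of the rewards of the current slot. The incumbent changes only at the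
end of a block, so within a block it is the frozen benchmark. -/
structure State (K S : ℕ) (V : Register) where
  init : Fin K
  inc : Fin K
  incSum : V.Carrier
  active : Fin S → Bool
  sum : Fin S → V.Carrier

variable {K S : ℕ} {V : Register}

def State.toProd (m : State K S V) :
    Fin K × Fin K × V.Carrier × (Fin S → Bool) × (Fin S → V.Carrier) :=
  (m.init, m.inc, m.incSum, m.active, m.sum)

instance : MeasurableSpace (State K S V) := MeasurableSpace.comap State.toProd inferInstance

/-- The number of rounds of a batch. -/
def batchLen (χ : Choices K S) (T : ℕ) : Batch → ℕ
  | .refresh i => len K T i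
  | .slot i j k => (χ.cut i (j + 1) - χ.cut i j) * len K T k
  | .final => T - mainRounds K T

/-- The boundaries of the batches. -/
def grid (χ : Choices K S) (T b : ℕ) : ℕ := (((schedule K S T).take b).map (batchLen χ T)).sum

/-- What happens to the memory at the start of a batch. -/
def startBatch (m : State K S V) : Batch → State K S V
  | .refresh _ => { m with init := m.inc, incSum := V.zero }
  | .slot _ _ k =>
    { m with
      active := if k = 1 then fun _ => true else m.active
      sum := fun _ => V.zero }
  | .final => m

/-- Round `τ` of slot `(i, j, k)` (counted from `0`) belongs to the `(τ / t_k)`-th arm of the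
block; `isActiveAt` tells whether that arm is still active. -/
def isActiveAt (T k τ : ℕ) (m : State K S V) : Prop :=
  ∃ q : Fin S, q.val = τ / len K T k ∧ m.active q = true

open Classical in
/-- The arm pulled in round `τ` of a batch, when `m` is the memory right after the start of the
batch. -/
def pull (χ : Choices K S) (T τ : ℕ) (m : State K S V) : Batch → Fin K
  | .refresh _ => m.inc
  | .slot i j k =>
    if isActiveAt T k τ m then χ.order i m.init (χ.cut i j + τ / len K T k) else m.inc
  | .final => m.inc

/-- How the reward `r` of round `τ` of a batch is recorded. The rewards of pulls of the benchmark in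
slots reserved for deactivated arms are discarded. -/
def record (T τ : ℕ) (r : ℝ) (m : State K S V) : Batch → State K S V
  | .refresh _ => { m with incSum := V.add m.incSum r }
  | .slot _ _ k =>
    { m with
      sum := fun q =>
        if q.val = τ / len K T k ∧ m.active q = true then V.add (m.sum q) r else m.sum q }
  | .final => m

/-- The empirical mean, in a slot at level `k`, of the `q`-th arm of the block. -/
def slotMean (T k : ℕ) (m : State K S V) (q : Fin S) : ℝ := V.val (m.sum q) / len K T k

/-- The stored summary of the incumbent in outer iteration `i`. -/
def incMean (T i : ℕ) (m : State K S V) : ℝ := V.val m.incSum / len K T i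

open Classical in
/-- Deactivation, at the end of slot `(i, j, k)`, of the arms whose empirical mean is below
the benchmark summary by more than `2 c(t_k)`. -/
def deactivate (T : ℕ) (δ : ℝ) (i k : ℕ) (m : State K S V) : State K S V :=
  { m with
    active := fun q => m.active q &&
      !decide (slotMean T k m q < incMean T i m - 2 * radius δ (len K T k)) }

open Classical in
/-- The positions in block `j` of the active arms. -/
def activeArms (χ : Choices K S) (i j : ℕ) (m : State K S V) : Finset (Fin S) :=
  Finset.univ.filter fun q => χ.cut i j + q.val < χ.cut i (j + 1) ∧ m.active q = true

open Classical in
/-- The positions of the active arms of block `j` with the largest empirical mean at level `i`. -/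
def bestArms (χ : Choices K S) (T i j : ℕ) (m : State K S V) : Finset (Fin S) :=
  (activeArms χ i j m).filter fun q => ∀ q' ∈ activeArms χ i j m, slotMean T i m q' ≤ slotMean T i m q

open Classical in
/-- The update of the incumbent at the end of block `j` of outer iteration `i`. -/
def replaceIncumbent (χ : Choices K S) (T : ℕ) (δ : ℝ) (i j : ℕ) (m : State K S V) :
    State K S V :=
  let q := χ.tie i j m.init (bestArms χ T i j m)
  if (activeArms χ i j m).Nonempty ∧
      incMean T i m + 2 * radius δ (len K T i) ≤ slotMean T i m q then
    { m with inc := χ.order i m.init (χ.cut i j + q.val), incSum := m.sum q }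
  else m

/-- What happens to the memory at the end of a batch. -/
def finishBatch (χ : Choices K S) (T : ℕ) (δ : ℝ) (m : State K S V) : Batch → State K S V
  | .refresh _ => m
  | .slot i j k =>
    let m' := deactivate T δ i k m
    if k = i then replaceIncumbent χ T δ i j m' else m'
  | .final => m

/-- The `b`-th batch. -/
def batch (K S T b : ℕ) : Batch := (schedule K S T).getD b Batch.final

/-- The batch that contains round `t`. -/
def batchIndex (χ : Choices K S) (T t : ℕ) : ℕ :=
  ((Finset.Ico 1 (schedule K S T).length).filter fun b => grid χ T b ≤ t).card

/-- The algorithm for `K` arms with block size `S`, horizon `T`, confidence parameter `δ`, open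
choices resolved by `χ`, and sums of rewards held in registers of type `V`. It is deterministic, so
the seed is trivial. -/
def algorithm [NeZero K] (χ : Choices K S) (T : ℕ) (δ : ℝ) (V : Register) : BatchedAlg K where
  Seed := Unit
  seedMeas := inferInstance
  seedLaw := Measure.dirac ()
  Mem := State K S V
  memMeas := inferInstance
  init := ⟨0, 0, V.zero, fun _ => false, fun _ => V.zero⟩
  batches := (schedule K S T).length
  grid := grid χ T
  plan b t m _ := pull χ T (t - grid χ T b) (startBatch m (batch K S T b)) (batch K S T b)
  update t m _ _ r :=
    let b := batchIndex χ T t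
    let β := batch K S T b
    let m₁ := if t = grid χ T b then startBatch m β else m
    let m₂ := record T (t - grid χ T b) r m₁ β
    if t + 1 = grid χ T (b + 1) then finishBatch χ T δ m₂ β else m₂

end BlockScan

end

/-! Put `N = T / (10 K)`. Up to a constant factor `t_i` is `N ^ (1 - 2 ^ (-i))` for `i ≤ L`, and
`t_L ≥ N / 4`. These lengths balance accuracy against cost. An arm that survives level `k` has gap
of order `c(t_k)`, so its `t_{k+1}` pulls at the next level cost about `t_{k+1} c(t_k)`, which is at
most a constant times `√(T log T / K)` at every level (`len_succ_mul_radius_le`). With fewer than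
`K` challengers, at most `L` levels and `L` outer iterations, exploration costs `O(L² √(K T log
T))`. The last incumbent has gap `O(c(t_L))`, so the final batch costs `O(√(K T log T))`.

The gaps are controlled on the event that every empirical mean over every window of rounds lies
within its radius (`GoodTable`). Outer iteration `i` starts with an incumbent of gap at most `4
c(t_{i-1})`. A survivor of level `k` is at most `4 c(t_k)` below the benchmark, and the best arm is
never deactivated (`SlotInv.step`). A replacement needs a margin of `2 c(t_i)`, so the true mean of
the incumbent never drops; after the block of the best arm has been scanned the incumbent has gap at
most `4 c(t_i)`, replaced or not (`SlotInv.replaceIncumbent`). Hoare triples that also carry a cost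
bound propagate this through the schedule (`cost_schedule_le`), and `sum_action_eq_cost` identifies
this batch-level semantics with the round-by-round run.

The windows in the good event are fixed in advance, so adaptivity plays no role: Hoeffding and a
union bound over at most `K T²` windows with `δ = T ^ (-4)` suffice (`measure_badTables_le`), and
failure adds at most `K / T ≤ 1` to the regret. Both versions are treated at once through
`Register.Stores`: the argument runs with the means of the rounded rewards, and true gaps differ by
at most `1 / T` per round. The batch and memory bounds are counts (`length_schedule_le`,
`algorithm_usesBits`). -/

namespace BlockScan

/-! ### Numerical bounds on the slot lengths -/

section Lengths

variable {K T : ℕ}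

lemma len_mul_le_len_succ_sq (K T i : ℕ) :
    (len K T i : ℝ) * ((T : ℝ) / (10 * K)) ≤ (len K T (i + 1) : ℝ) ^ 2 := by
  have h : √((len K T i : ℝ) * ((T : ℝ) / (10 * K))) ≤ len K T (i + 1) := Nat.le_ceil _
  exact (Real.sqrt_le_left (by positivity)).1 h

lemma one_le_len (h : 0 < (T : ℝ) / (10 * K)) (i : ℕ) : 1 ≤ len K T i := by
  induction i with
  | zero => exact le_rfl
  | succ i ih =>
    refine Nat.one_le_iff_ne_zero.2 (Nat.pos_iff_ne_zero.1 (Nat.ceil_pos.2 (Real.sqrt_pos.2 ?_)))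
    have : (0 : ℝ) < len K T i := by exact_mod_cast ih
    positivity

lemma len_succ_le_sqrt_add_one (K T i : ℕ) :
    (len K T (i + 1) : ℝ) ≤ √((len K T i : ℝ) * ((T : ℝ) / (10 * K))) + 1 :=
  (Nat.ceil_lt_add_one (Real.sqrt_nonneg _)).le

lemma len_succ_le_two_mul_sqrt (h : 1 ≤ (T : ℝ) / (10 * K)) (i : ℕ) :
    (len K T (i + 1) : ℝ) ≤ 2 * √((len K T i : ℝ) * ((T : ℝ) / (10 * K))) := by
  have h1 := len_succ_le_sqrt_add_one K T i
  have h2 : (1 : ℝ) ≤ len K T i := by exact_mod_cast one_le_len (by linarith) i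
  have h3 : 1 ≤ √((len K T i : ℝ) * ((T : ℝ) / (10 * K))) :=
    Real.one_le_sqrt.2 (by nlinarith)
  linarith

lemma rpow_half_pow_succ_sq {N : ℝ} (hN : 0 ≤ N) (i : ℕ) :
    (N ^ ((1 / 2 : ℝ) ^ (i + 1))) ^ 2 = N ^ ((1 / 2 : ℝ) ^ i) := by
  rw [← Real.rpow_natCast, ← Real.rpow_mul hN]
  congr 1
  rw [pow_succ]
  push_cast
  ring

/-- Without the ceiling, `t_i * N ^ (2 ^ (-i)) = N` would hold exactly. The factor `11/10`
reproduces itself under the recursion because the square root damps it and the ceiling adds only `y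
≤ √N ≤ N / 100`. -/
lemma len_mul_rpow_le (h : 10000 ≤ (T : ℝ) / (10 * K)) (i : ℕ) :
    (len K T i : ℝ) * ((T : ℝ) / (10 * K)) ^ ((1 / 2 : ℝ) ^ i) ≤
      11 / 10 * ((T : ℝ) / (10 * K)) := by
  induction i with
  | zero => simp [len]; linarith
  | succ i ih =>
    have h1 := len_succ_le_sqrt_add_one K T i
    set N := (T : ℝ) / (10 * K)
    have hN : 0 ≤ N := by linarith
    have h2 := rpow_half_pow_succ_sq hN i
    have h3 : N ^ ((1 / 2 : ℝ) ^ i) ≤ N := by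
      refine Real.rpow_le_self_of_one_le (by linarith) (pow_le_one₀ (by norm_num) (by norm_num))
    set y := N ^ ((1 / 2 : ℝ) ^ (i + 1))
    have hy : 0 ≤ y := Real.rpow_nonneg hN _
    have h4 : y ≤ N / 100 := abs_le_of_sq_le_sq' (by nlinarith) (by positivity) |>.2
    -- Here `(21/20)² ≥ 11/10`, and `21/20 + 1/100 ≤ 11/10` leaves room for the ceiling.
    have h5 : √(len K T i * N) * y ≤ 21 / 20 * N := by
      refine abs_le_of_sq_le_sq' ?_ (by positivity) |>.2
      rw [mul_pow, Real.sq_sqrt (by positivity), h2]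
      nlinarith
    nlinarith

lemma le_len_mul_rpow (K T i : ℕ) :
    (T : ℝ) / (10 * K) ≤ len K T i * ((T : ℝ) / (10 * K)) ^ ((1 / 2 : ℝ) ^ i) := by
  induction i with
  | zero => simp [len]
  | succ i ih =>
    have h1 := len_mul_le_len_succ_sq K T i
    set N := (T : ℝ) / (10 * K)
    have hN : 0 ≤ N := by positivity
    have h2 := rpow_half_pow_succ_sq hN i
    set y := N ^ ((1 / 2 : ℝ) ^ (i + 1))
    have hy : 0 ≤ y := Real.rpow_nonneg hN _
    refine abs_le_of_sq_le_sq' ?_ (by positivity) |>.2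
    rw [mul_pow, h2]
    rw [← h2] at ih ⊢
    nlinarith [sq_nonneg y]

lemma two_pow_numOuter_le (h : 4 ≤ (T : ℝ) / (10 * K)) :
    (2 : ℝ) ^ numOuter K T ≤ Real.logb 2 ((T : ℝ) / (10 * K)) ∧
      Real.logb 2 ((T : ℝ) / (10 * K)) < 2 ^ (numOuter K T + 1) := by
  set N := (T : ℝ) / (10 * K)
  have h1 : 2 ≤ Real.logb 2 N := by
    rw [Real.le_logb_iff_rpow_le (by norm_num) (by linarith)]
    norm_num; exact h
  have h2 : 0 ≤ Real.logb 2 (Real.logb 2 N) := Real.logb_nonneg (by norm_num) (by linarith)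
  constructor
  · have := Nat.floor_le h2
    rw [Real.le_logb_iff_rpow_le (by norm_num) (by linarith)] at this
    rwa [← Real.rpow_natCast]
  · have := Nat.lt_floor_add_one (Real.logb 2 (Real.logb 2 N))
    rw [Real.logb_lt_iff_lt_rpow (by norm_num) (by linarith)] at this
    rw [← Real.rpow_natCast]
    push_cast
    exact this

lemma one_le_numOuter (h : 4 ≤ (T : ℝ) / (10 * K)) : 1 ≤ numOuter K T := by
  have h1 := (two_pow_numOuter_le h).2
  have h2 : 2 ≤ Real.logb 2 ((T : ℝ) / (10 * K)) := by
    rw [Real.le_logb_iff_rpow_le (by norm_num) (by linarith)]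
    norm_num; exact h
  by_contra hc
  have : numOuter K T = 0 := by omega
  rw [this] at h1
  norm_num at h1
  linarith

lemma rpow_eq_two_rpow {N : ℝ} (hN : 0 < N) (s : ℝ) : N ^ s = 2 ^ (Real.logb 2 N * s) := by
  rw [Real.rpow_mul (by norm_num), Real.rpow_logb (by norm_num) (by norm_num) hN]

/-- This and `rpow_numOuter_le_four` express the choice of `L`: it is the last index at which `N ^
(2 ^ (-i))` is still at least `2`. Hence `t_i` stays a constant factor below `N`, while `t_L` is
comparable to `N`. -/
lemma two_le_rpow (h : 4 ≤ (T : ℝ) / (10 * K)) {i : ℕ} (hi : i ≤ numOuter K T) :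
    2 ≤ ((T : ℝ) / (10 * K)) ^ ((1 / 2 : ℝ) ^ i) := by
  have h1 := (two_pow_numOuter_le h).1
  rw [rpow_eq_two_rpow (by linarith)]
  have h2 : (2 : ℝ) ^ i ≤ 2 ^ numOuter K T := pow_le_pow_right₀ (by norm_num) hi
  have h3 : 1 ≤ Real.logb 2 ((T : ℝ) / (10 * K)) * (1 / 2 : ℝ) ^ i := by
    rw [one_div, inv_pow, ← div_eq_mul_inv, one_le_div (by positivity)]
    linarith
  calc (2 : ℝ) = 2 ^ (1 : ℝ) := by simp
    _ ≤ _ := Real.rpow_le_rpow_of_exponent_le (by norm_num) h3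

lemma rpow_numOuter_le_four (h : 4 ≤ (T : ℝ) / (10 * K)) :
    ((T : ℝ) / (10 * K)) ^ ((1 / 2 : ℝ) ^ numOuter K T) ≤ 4 := by
  have h1 := (two_pow_numOuter_le h).2
  rw [rpow_eq_two_rpow (by linarith)]
  have h3 : Real.logb 2 ((T : ℝ) / (10 * K)) * (1 / 2 : ℝ) ^ numOuter K T ≤ 2 := by
    rw [one_div, inv_pow, ← div_eq_mul_inv, div_le_iff₀ (by positivity)]
    rw [pow_succ] at h1
    linarith
  calc _ ≤ (2 : ℝ) ^ (2 : ℝ) := Real.rpow_le_rpow_of_exponent_le (by norm_num) h3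
    _ = 4 := by norm_num

lemma len_le_of_le_numOuter (h : 10000 ≤ (T : ℝ) / (10 * K)) {i : ℕ} (hi : i ≤ numOuter K T) :
    (len K T i : ℝ) ≤ 11 / 20 * ((T : ℝ) / (10 * K)) := by
  have h1 := len_mul_rpow_le h i
  have h2 := two_le_rpow (by linarith) hi
  have h3 : (0 : ℝ) ≤ len K T i := by positivity
  nlinarith

lemma div_four_le_len_numOuter (h : 4 ≤ (T : ℝ) / (10 * K)) :
    (T : ℝ) / (10 * K) / 4 ≤ len K T (numOuter K T) := by
  have h1 := le_len_mul_rpow K T (numOuter K T)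
  have h2 := rpow_numOuter_le_four h
  have h3 : (0 : ℝ) ≤ len K T (numOuter K T) := by positivity
  nlinarith

/-- From `t_i N ≤ t_{i+1}²` and `t_{i+1} ≤ (11/20) N`. The lengths grow geometrically, so their sums
are dominated by the last term, with factor `1 / (1 - 11/20) = 20/9`. -/
lemma len_le_mul_len_succ (h : 10000 ≤ (T : ℝ) / (10 * K)) {i : ℕ} (hi : i < numOuter K T) :
    (len K T i : ℝ) ≤ 11 / 20 * len K T (i + 1) := by
  have h1 := len_mul_le_len_succ_sq K T i
  have h2 := len_le_of_le_numOuter h (i := i + 1) hi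
  set N := (T : ℝ) / (10 * K)
  have hN : 0 < N := by linarith
  have h3 : (0 : ℝ) ≤ len K T (i + 1) := by positivity
  refine le_of_mul_le_mul_right ?_ hN
  nlinarith

lemma len_mono (h : 10000 ≤ (T : ℝ) / (10 * K)) {i k : ℕ} (hik : i ≤ k)
    (hk : k ≤ numOuter K T) : len K T i ≤ len K T k := by
  induction k, hik using Nat.le_induction with
  | base => exact le_rfl
  | succ k hik ih =>
    refine (ih (by omega)).trans ?_
    have h1 := len_le_mul_len_succ h (i := k) hk
    have h3 : (0 : ℝ) ≤ len K T (k + 1) := by positivity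
    have : (len K T k : ℝ) ≤ len K T (k + 1) := by linarith
    exact_mod_cast this

lemma sum_len_le (h : 10000 ≤ (T : ℝ) / (10 * K)) {i : ℕ} (hi : i ≤ numOuter K T) :
    ∑ k ∈ Finset.Icc 1 i, (len K T k : ℝ) ≤ 20 / 9 * len K T i := by
  induction i with
  | zero => simp [len]; norm_num
  | succ i ih =>
    rw [Finset.sum_Icc_succ_top (by omega)]
    have h1 := len_le_mul_len_succ h (i := i) hi
    have h2 := ih (by omega)
    linarith

/-- Summing the geometric growth twice, over levels and over outer iterations, gives at most
`(20/9)² (11/20) K N < 10 K N = T`. Strictness makes the final batch nonempty. -/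
lemma mainRounds_lt (hK : 1 ≤ K) (h : 10000 ≤ (T : ℝ) / (10 * K)) : mainRounds K T < T := by
  have hK' : (1 : ℝ) ≤ K := by exact_mod_cast hK
  have h1 : (mainRounds K T : ℝ) ≤
      ∑ i ∈ Finset.Icc 1 (numOuter K T), 20 / 9 * K * (len K T i : ℝ) := by
    unfold mainRounds
    push_cast [Nat.cast_sub hK]
    refine Finset.sum_le_sum fun i hi => ?_
    have h2 := sum_len_le h (Finset.mem_Icc.1 hi).2
    have h3 : (0 : ℝ) ≤ len K T i := by positivity
    have h4 := mul_le_mul_of_nonneg_left h2 (sub_nonneg.2 hK')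
    nlinarith
  rw [← Finset.mul_sum] at h1
  have h2 := sum_len_le h le_rfl
  have h3 := len_le_of_le_numOuter h le_rfl
  have h4 : (mainRounds K T : ℝ) ≤ 20 / 9 * K * (20 / 9 * (11 / 20 * ((T : ℝ) / (10 * K)))) := by
    refine h1.trans (mul_le_mul_of_nonneg_left (h2.trans ?_) (by positivity))
    linarith
  have h5 : (T : ℝ) = 10 * K * ((T : ℝ) / (10 * K)) := by field_simp
  have h6 : (0 : ℝ) < K * ((T : ℝ) / (10 * K)) := by
    have : 0 < (T : ℝ) / (10 * K) := by linarith
    positivity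
  have : (mainRounds K T : ℝ) < T := by
    rw [h5]
    nlinarith
  exact_mod_cast this

lemma one_le_log_log {T : ℕ} (hT : 16 ≤ T) : 1 ≤ Real.log (Real.log T) := by
  have h2 : (16 : ℝ) ≤ T := by exact_mod_cast hT
  have h3 : Real.log 16 ≤ Real.log T := Real.log_le_log (by norm_num) h2
  have h4 : Real.log 16 = 4 * Real.log 2 := by
    rw [show (16 : ℝ) = 2 ^ 4 by norm_num, Real.log_pow]; norm_num
  have h5 := Real.log_two_gt_d9
  have h6 := Real.exp_one_lt_d9
  rw [Real.le_log_iff_exp_le (by linarith)]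
  linarith

lemma numOuter_le (hK : 1 ≤ K) (h : 4 ≤ (T : ℝ) / (10 * K)) (hT : 16 ≤ T) :
    (numOuter K T : ℝ) ≤ 3 * Real.log (Real.log T) := by
  have hK' : (1 : ℝ) ≤ K := by exact_mod_cast hK
  have h1 := one_le_log_log hT
  have hT' : (16 : ℝ) ≤ T := by exact_mod_cast hT
  have hlogT : 0 < Real.log T := Real.log_pos (by linarith)
  have h5 := Real.log_two_gt_d9
  have hNT : (T : ℝ) / (10 * K) ≤ T := div_le_self (by positivity) (by linarith)
  have h2 := (two_pow_numOuter_le h).1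
  have h3 : Real.logb 2 ((T : ℝ) / (10 * K)) ≤ 2 * Real.log T := by
    rw [Real.logb, div_le_iff₀ (by linarith)]
    have := Real.log_le_log (by linarith) hNT
    nlinarith
  have h4 := Real.log_le_log (by positivity) (h2.trans h3)
  rw [Real.log_pow, Real.log_mul (by norm_num) hlogT.ne'] at h4
  nlinarith

end Lengths

end BlockScan

namespace BlockScan

/-! ### The layout of the batches -/

section Layout

variable {K S T : ℕ}

lemma numBlocks_pos (hK : 2 ≤ K) (hS : 1 ≤ S) : 1 ≤ numBlocks K S := by
  have hK' : (2 : ℝ) ≤ K := by exact_mod_cast hK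
  have hS' : (1 : ℝ) ≤ S := by exact_mod_cast hS
  exact Nat.ceil_pos.2 (div_pos (by linarith) (by linarith))

lemma numBlocks_lt (hK : 2 ≤ K) : (numBlocks K S : ℝ) < ((K : ℝ) - 1) / S + 1 := by
  have hK' : (2 : ℝ) ≤ K := by exact_mod_cast hK
  exact Nat.ceil_lt_add_one (div_nonneg (by linarith) (by positivity))

lemma numBlocks_le (hK : 2 ≤ K) (hS : 1 ≤ S) (hSK : S ≤ K) :
    (numBlocks K S : ℝ) ≤ 2 * (K / S) := by
  have hS' : (1 : ℝ) ≤ S := by exact_mod_cast hS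
  have hSK' : (S : ℝ) ≤ K := by exact_mod_cast hSK
  have h1 := numBlocks_lt (S := S) hK
  have h2 : (1 : ℝ) ≤ K / S := (one_le_div (by linarith)).2 hSK'
  have h3 : ((K : ℝ) - 1) / S ≤ K / S := by gcongr; linarith
  linarith

lemma numBlocks_sub_one_mul_lt (hK : 2 ≤ K) (hS : 1 ≤ S) :
    (numBlocks K S - 1) * S < K - 1 := by
  have h1 := numBlocks_lt (S := S) hK
  have h2 := numBlocks_pos hK hS
  have hS' : (1 : ℝ) ≤ S := by exact_mod_cast hS
  have h3 : ((numBlocks K S : ℝ) - 1) * S < K - 1 := by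
    rw [← lt_div_iff₀ (by linarith)]; linarith
  have : (((numBlocks K S - 1) * S : ℕ) : ℝ) < ((K - 1 : ℕ) : ℝ) := by
    push_cast [Nat.cast_sub h2, Nat.cast_sub (show 1 ≤ K by omega)]
    exact h3
  exact_mod_cast this

/-! ### Nonempty blocks -/

namespace Choices

lemma cut_add_le (χ : Choices K S) (i j n : ℕ) : χ.cut i (j + n) ≤ χ.cut i j + n * S := by
  induction n with
  | zero => simp
  | succ n ih =>
    have := χ.cut_size i (j + n)
    rw [← add_assoc, add_mul, one_mul]
    omega

/-- If block `j` were empty, the other `J - 1` blocks would have to hold `K - 1` arms, but `(J - 1)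
S < K - 1`. Without this a slot could have no rounds and the grid would not increase strictly. -/
lemma cut_lt_cut_succ (χ : Choices K S) (hK : 2 ≤ K) (hS : 1 ≤ S) (i : ℕ) {j : ℕ}
    (hj : j < numBlocks K S) : χ.cut i j < χ.cut i (j + 1) := by
  by_contra hc
  have h0 := χ.cut_add_le i 0 j
  have h1 := χ.cut_add_le i (j + 1) (numBlocks K S - 1 - j)
  have h2 := numBlocks_sub_one_mul_lt hK hS
  rw [show j + 1 + (numBlocks K S - 1 - j) = numBlocks K S by omega, χ.cut_last] at h1
  rw [zero_add, χ.cut_zero] at h0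
  have h3 : j * S + (numBlocks K S - 1 - j) * S = (numBlocks K S - 1) * S := by
    rw [← add_mul]; congr 1; omega
  omega

end Choices

variable (χ : Choices K S)

/-- The number of rounds of a list of batches. -/
noncomputable def rounds (χ : Choices K S) (T : ℕ) (l : List Batch) : ℕ := (l.map (batchLen χ T)).sum

@[simp] lemma rounds_nil : rounds χ T [] = 0 := rfl

@[simp] lemma rounds_cons (β : Batch) (l : List Batch) :
    rounds χ T (β :: l) = batchLen χ T β + rounds χ T l := by simp [rounds]

@[simp] lemma rounds_append (l l' : List Batch) :
    rounds χ T (l ++ l') = rounds χ T l + rounds χ T l' := by simp [rounds]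

lemma rounds_flatMap_range (f : ℕ → List Batch) (n : ℕ) :
    rounds χ T ((List.range n).flatMap f) = ∑ i ∈ Finset.range n, rounds χ T (f i) := by
  induction n with
  | zero => simp
  | succ n ih => simp [List.range_succ, ih, Finset.sum_range_succ]

/-- The slots of the block `j` in outer iteration `i + 1`. -/
def blockSlots (i j : ℕ) : List Batch := (List.range (i + 1)).map fun k => Batch.slot (i + 1) j (k + 1)

/-- The batches of outer iteration `i + 1`. -/
noncomputable def outerBatches (K S i : ℕ) : List Batch :=
  Batch.refresh (i + 1) :: (List.range (numBlocks K S)).flatMap (blockSlots i)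

lemma schedule_eq (K S T : ℕ) :
    schedule K S T = (List.range (numOuter K T)).flatMap (outerBatches K S) ++ [Batch.final] := rfl

lemma rounds_blockSlots (i j : ℕ) :
    rounds χ T (blockSlots i j) =
      (χ.cut (i + 1) (j + 1) - χ.cut (i + 1) j) * ∑ k ∈ Finset.Icc 1 (i + 1), len K T k := by
  have h : blockSlots i j = (List.range (i + 1)).flatMap fun k => [Batch.slot (i + 1) j (k + 1)] := by
    rw [blockSlots, List.map_eq_flatMap]
  rw [h, rounds_flatMap_range, Finset.mul_sum, Finset.range_eq_Ico, Finset.sum_Ico_eq_sum_range,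
    ← Finset.Ico_add_one_right_eq_Icc, Finset.sum_Ico_eq_sum_range]
  simp [batchLen, add_comm]

lemma sum_block_sizes (i : ℕ) :
    ∑ j ∈ Finset.range (numBlocks K S), (χ.cut i (j + 1) - χ.cut i j) = K - 1 := by
  rw [Finset.sum_range_tsub (χ.cut_mono i), χ.cut_last, χ.cut_zero, Nat.sub_zero]

lemma rounds_outerBatches (i : ℕ) :
    rounds χ T (outerBatches K S i) =
      len K T (i + 1) + (K - 1) * ∑ k ∈ Finset.Icc 1 (i + 1), len K T k := by
  rw [outerBatches, rounds_cons, rounds_flatMap_range]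
  simp only [rounds_blockSlots]
  rw [← Finset.sum_mul, sum_block_sizes]
  rfl

lemma rounds_main : rounds χ T ((List.range (numOuter K T)).flatMap (outerBatches K S)) =
    mainRounds K T := by
  rw [rounds_flatMap_range, mainRounds, ← Finset.Ico_add_one_right_eq_Icc,
    Finset.sum_Ico_eq_sum_range]
  simp [rounds_outerBatches, add_comm]

lemma rounds_schedule (h : mainRounds K T ≤ T) : rounds χ T (schedule K S T) = T := by
  rw [schedule_eq, rounds_append, rounds_main]
  simp [batchLen]
  omega

lemma batchLen_pos (hK : 2 ≤ K) (hS : 1 ≤ S) (hN : 0 < (T : ℝ) / (10 * K))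
    (h : mainRounds K T < T) {β : Batch} (hβ : β ∈ schedule K S T) : 0 < batchLen χ T β := by
  simp only [schedule, List.mem_append, List.mem_flatMap, List.mem_range, List.mem_cons,
    List.mem_map, List.not_mem_nil, or_false] at hβ
  obtain ⟨i, -, rfl | ⟨j, hj, k, -, rfl⟩⟩ | rfl := hβ
  · exact one_le_len hN _
  · exact Nat.mul_pos (Nat.sub_pos_of_lt (χ.cut_lt_cut_succ hK hS _ hj)) (one_le_len hN _)
  · exact Nat.sub_pos_of_lt h

lemma grid_eq_rounds (b : ℕ) : grid χ T b = rounds χ T ((schedule K S T).take b) := rfl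

lemma grid_zero : grid χ T 0 = 0 := by simp [grid]

lemma grid_succ {b : ℕ} (hb : b < (schedule K S T).length) :
    grid χ T (b + 1) = grid χ T b + batchLen χ T (batch K S T b) := by
  rw [grid_eq_rounds, grid_eq_rounds, List.take_succ_eq_append_getElem hb, rounds_append, batch,
    List.getD_eq_getElem _ _ hb]
  simp

lemma grid_length (h : mainRounds K T ≤ T) : grid χ T (schedule K S T).length = T := by
  rw [grid_eq_rounds, List.take_length, rounds_schedule χ h]

lemma batch_mem {b : ℕ} (hb : b < (schedule K S T).length) :
    batch K S T b ∈ schedule K S T := by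
  rw [batch, List.getD_eq_getElem _ _ hb]
  exact List.getElem_mem hb

lemma grid_lt_grid_succ (hK : 2 ≤ K) (hS : 1 ≤ S) (hN : 0 < (T : ℝ) / (10 * K))
    (h : mainRounds K T < T) {b : ℕ} (hb : b < (schedule K S T).length) :
    grid χ T b < grid χ T (b + 1) := by
  rw [grid_succ χ hb]
  exact Nat.lt_add_of_pos_right (batchLen_pos χ hK hS hN h (batch_mem hb))

lemma grid_mono : Monotone (grid χ T) := by
  refine monotone_nat_of_le_succ fun b => ?_
  by_cases hb : b < (schedule K S T).length
  · rw [grid_succ χ hb]; omega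
  · rw [grid_eq_rounds, grid_eq_rounds, List.take_of_length_le (by omega),
      List.take_of_length_le (by omega)]

/-- Each outer iteration has one refresh and at most `L` slots for each of the `J` blocks, so the
count is at most `L (1 + J L) + 1`; as `J, L ≥ 1`, each of the three terms is at most `J L²`. -/
lemma length_schedule_le (hK : 2 ≤ K) (hS : 1 ≤ S) (hL : 1 ≤ numOuter K T) :
    (schedule K S T).length ≤ 3 * numBlocks K S * numOuter K T ^ 2 := by
  have h : ∀ n ≤ numOuter K T, ((List.range n).flatMap (outerBatches K S)).length ≤
      n * (1 + numBlocks K S * numOuter K T) := by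
    intro n hn
    induction n with
    | zero => simp
    | succ n ih =>
      have h1 : (outerBatches K S n).length ≤ 1 + numBlocks K S * numOuter K T := by
        simp only [outerBatches, blockSlots, List.length_cons, List.length_flatMap,
          List.length_map, List.length_range, List.map_const', List.sum_replicate, smul_eq_mul]
        rw [add_comm]
        gcongr
      simp only [List.range_succ, List.flatMap_append, List.length_append, List.flatMap_cons,
        List.flatMap_nil, List.append_nil]
      have := ih (by omega)
      rw [add_mul, one_mul]
      omega
  have h1 := h _ le_rfl
  have hJ := numBlocks_pos hK hS
  rw [schedule_eq, List.length_append, List.length_singleton]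
  nlinarith [Nat.mul_le_mul hL hL, Nat.mul_le_mul hJ hL, Nat.mul_le_mul hJ (Nat.mul_le_mul hL hL)]

end Layout

end BlockScan

namespace BlockScan

/-! ### Execution batch by batch -/

section Execution

variable {K S : ℕ} {V : Register}

/-- The memory after `τ` rounds of the batch `β` that starts at time `s` with memory `m`. -/
noncomputable def batchFold (χ : Choices K S) (T : ℕ) (x : ℕ → Fin K → ℝ) (s : ℕ)
    (m : State K S V) (β : Batch) : ℕ → State K S V
  | 0 => startBatch m β
  | τ + 1 => record T τ (x (s + τ) (pull χ T τ (startBatch m β) β)) (batchFold χ T x s m β τ) β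

/-- The memory after the batch `β` that starts at time `s` with memory `m`. -/
noncomputable def batchStep (χ : Choices K S) (T : ℕ) (δ : ℝ) (x : ℕ → Fin K → ℝ) (s : ℕ)
    (m : State K S V) (β : Batch) : State K S V :=
  finishBatch χ T δ (batchFold χ T x s m β (batchLen χ T β)) β

/-- The memory after a list of batches. -/
noncomputable def exec (χ : Choices K S) (T : ℕ) (δ : ℝ) (x : ℕ → Fin K → ℝ) :
    List Batch → ℕ → State K S V → State K S V
  | [], _, m => m
  | β :: l, s, m => exec χ T δ x l (s + batchLen χ T β) (batchStep χ T δ x s m β)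

/-- The total of `g` over the arms pulled in a batch. -/
noncomputable def batchCost (χ : Choices K S) (T : ℕ) (g : Fin K → ℝ)
    (m : State K S V) (β : Batch) : ℝ :=
  ∑ τ ∈ Finset.range (batchLen χ T β), g (pull χ T τ (startBatch m β) β)

/-- The total of `g` over the arms pulled in a list of batches. -/
noncomputable def cost (χ : Choices K S) (T : ℕ) (δ : ℝ) (x : ℕ → Fin K → ℝ) (g : Fin K → ℝ) :
    List Batch → ℕ → State K S V → ℝ
  | [], _, _ => 0
  | β :: l, s, m => batchCost χ T g m β +
      cost χ T δ x g l (s + batchLen χ T β) (batchStep χ T δ x s m β)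

variable (χ : Choices K S) (T : ℕ) (δ : ℝ) (x : ℕ → Fin K → ℝ) (g : Fin K → ℝ)

lemma exec_append (l l' : List Batch) (s : ℕ) (m : State K S V) :
    exec χ T δ x (l ++ l') s m = exec χ T δ x l' (s + rounds χ T l) (exec χ T δ x l s m) := by
  induction l generalizing s m with
  | nil => simp [exec]
  | cons β l ih => simp [exec, ih, add_assoc]

lemma cost_append (l l' : List Batch) (s : ℕ) (m : State K S V) :
    cost χ T δ x g (l ++ l') s m = cost χ T δ x g l s m +
      cost χ T δ x g l' (s + rounds χ T l) (exec χ T δ x l s m) := by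
  induction l generalizing s m with
  | nil => simp [exec, cost]
  | cons β l ih => simp [exec, cost, ih, add_assoc]

variable {T}

/-- The boundaries of the batches increase strictly up to the last one. -/
def StrictGrid (χ : Choices K S) (T : ℕ) : Prop :=
  ∀ b < (schedule K S T).length, grid χ T b < grid χ T (b + 1)

variable {χ}

lemma batchIndex_eq {b t : ℕ} (hb : b < (schedule K S T).length) (h1 : grid χ T b ≤ t)
    (h2 : t < grid χ T (b + 1)) : batchIndex χ T t = b := by
  have : ((Finset.Ico 1 (schedule K S T).length).filter fun b => grid χ T b ≤ t) =
      Finset.Ico 1 (b + 1) := by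
    ext b'
    simp only [Finset.mem_filter, Finset.mem_Ico]
    constructor
    · rintro ⟨⟨h3, -⟩, h4⟩
      refine ⟨h3, ?_⟩
      by_contra hc
      have := grid_mono χ (T := T) (not_lt.1 hc)
      omega
    · rintro ⟨h3, h4⟩
      exact ⟨⟨h3, by omega⟩, (grid_mono χ (Nat.lt_succ_iff.1 h4)).trans h1⟩
  rw [batchIndex, this]
  simp

lemma mem_image_grid_iff {b t : ℕ} (hb : b < (schedule K S T).length) (h1 : grid χ T b ≤ t)
    (h2 : t < grid χ T (b + 1)) :
    t + 1 ∈ (Finset.range ((schedule K S T).length + 1)).image (grid χ T) ↔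
      t + 1 = grid χ T (b + 1) := by
  constructor
  · intro h
    obtain ⟨b', hb', h3⟩ := Finset.mem_image.1 h
    by_cases hbb : b' ≤ b
    · have := grid_mono χ (T := T) hbb
      omega
    · have := grid_mono χ (T := T) (show b + 1 ≤ b' by omega)
      omega
  · intro h
    exact Finset.mem_image.2 ⟨b + 1, by simpa using hb, h.symm⟩

lemma batchLen_pos_of_strictGrid (hg : StrictGrid χ T) {b : ℕ}
    (hb : b < (schedule K S T).length) : 0 < batchLen χ T (batch K S T b) := by
  have h1 := hg b hb
  rw [grid_succ χ hb] at h1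
  omega

variable [NeZero K]

/-- The initial memory. -/
def initState (K S : ℕ) (V : Register) [NeZero K] : State K S V :=
  ⟨0, 0, V.zero, fun _ => false, fun _ => V.zero⟩

variable (χ T V) in
/-- The memory at the last batch boundary and the current memory. -/
noncomputable def runState (t : ℕ) : State K S V × State K S V :=
  (algorithm χ T δ V).run () x t

lemma runState_succ (t : ℕ) :
    runState V χ T δ x (t + 1) =
      let s := runState V χ T δ x t
      let b := batchIndex χ T t
      let β := batch K S T b
      let a := pull χ T (t - grid χ T b) (startBatch s.1 β) β
      let m₁ := if t = grid χ T b then startBatch s.2 β else s.2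
      let m₂ := record T (t - grid χ T b) (x t a) m₁ β
      let m := if t + 1 = grid χ T (b + 1) then finishBatch χ T δ m₂ β else m₂
      (if t + 1 ∈ (Finset.range ((schedule K S T).length + 1)).image (grid χ T) then m else s.1,
        m) := rfl

lemma runState_succ_of_mem_batch {b t : ℕ} (hb : b < (schedule K S T).length)
    (h1 : grid χ T b ≤ t) (h2 : t < grid χ T (b + 1)) :
    runState V χ T δ x (t + 1) =
      let s := runState V χ T δ x t
      let β := batch K S T b
      let a := pull χ T (t - grid χ T b) (startBatch s.1 β) β
      let m₁ := if t = grid χ T b then startBatch s.2 β else s.2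
      let m₂ := record T (t - grid χ T b) (x t a) m₁ β
      let m := if t + 1 = grid χ T (b + 1) then finishBatch χ T δ m₂ β else m₂
      (if t + 1 = grid χ T (b + 1) then m else s.1, m) := by
  rw [runState_succ]
  simp only [batchIndex_eq hb h1 h2, mem_image_grid_iff hb h1 h2]

lemma action_eq (u : Unit) (t : ℕ) :
    (algorithm χ T δ V).action u x t =
      pull χ T (t - grid χ T (batchIndex χ T t))
        (startBatch (runState V χ T δ x t).1 (batch K S T (batchIndex χ T t)))
        (batch K S T (batchIndex χ T t)) := rfl

/-- The case `τ = 0` is separate because the start-of-batch reset happens in the first update of the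
batch, so at the boundary the stored memory is still `m`. The first component stays `m`, which is
why the whole batch is planned from the boundary memory. -/
lemma runState_within_batch {b : ℕ} (hb : b < (schedule K S T).length)
    {m : State K S V} (hm : runState V χ T δ x (grid χ T b) = (m, m)) {τ : ℕ}
    (hτ : τ < batchLen χ T (batch K S T b)) :
    runState V χ T δ x (grid χ T b + τ) =
      (m, if τ = 0 then m else batchFold χ T x (grid χ T b) m (batch K S T b) τ) := by
  induction τ with
  | zero => simpa using hm
  | succ τ ih =>
    have h := grid_succ χ hb
    rw [← add_assoc, runState_succ_of_mem_batch δ x hb (by omega) (by omega), ih (by omega)]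
    have h1 : ¬ grid χ T b + τ + 1 = grid χ T (b + 1) := by omega
    simp only [h1, if_false]
    rcases Nat.eq_zero_or_pos τ with rfl | h0
    · simp [batchFold]
    · simp [batchFold, h0.ne']

lemma runState_grid_succ {b : ℕ} (hb : b < (schedule K S T).length)
    (hpos : 0 < batchLen χ T (batch K S T b))
    {m : State K S V} (hm : runState V χ T δ x (grid χ T b) = (m, m)) :
    runState V χ T δ x (grid χ T (b + 1)) =
      (batchStep χ T δ x (grid χ T b) m (batch K S T b),
        batchStep χ T δ x (grid χ T b) m (batch K S T b)) := by
  obtain ⟨n, hn⟩ : ∃ n, batchLen χ T (batch K S T b) = n + 1 := ⟨_, (Nat.succ_pred hpos.ne').symm⟩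
  have h := grid_succ χ hb
  have h1 : grid χ T (b + 1) = grid χ T b + n + 1 := by omega
  have h2 := runState_succ_of_mem_batch (χ := χ) δ x (V := V) hb (t := grid χ T b + n)
    (by omega) (by omega)
  rw [runState_within_batch δ x hb hm (by omega)] at h2
  rw [h1, h2, batchStep, hn]
  simp only [← h1, if_true]
  rcases Nat.eq_zero_or_pos n with rfl | h0
  · simp [batchFold]
  · simp [batchFold, h0.ne']

/-- Links the round-by-round run to the fold over the list of batches, on which induction is easy.
Both components agree at a boundary, so the fold needs only one state. -/
lemma runState_grid (hg : StrictGrid χ T) {b : ℕ} (hb : b ≤ (schedule K S T).length) :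
    runState V χ T δ x (grid χ T b) =
      (exec χ T δ x ((schedule K S T).take b) 0 (initState K S V),
        exec χ T δ x ((schedule K S T).take b) 0 (initState K S V)) := by
  induction b with
  | zero =>
    rw [grid_zero]
    rfl
  | succ b ih =>
    rw [runState_grid_succ δ x hb (batchLen_pos_of_strictGrid hg hb) (ih (by omega)),
      List.take_succ_eq_append_getElem hb, exec_append, zero_add, ← grid_eq_rounds]
    simp [exec, batch, List.getElem?_eq_getElem hb]

lemma sum_action_grid (hg : StrictGrid χ T) (u : Unit) {b : ℕ}
    (hb : b ≤ (schedule K S T).length) :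
    ∑ t ∈ Finset.range (grid χ T b), g ((algorithm χ T δ V).action u x t) =
      cost χ T δ x g ((schedule K S T).take b) 0 (initState K S V) := by
  induction b with
  | zero => simp [grid_zero, cost]
  | succ b ih =>
    have h := grid_succ χ hb
    have hm := runState_grid (V := V) δ x hg (b := b) (by omega)
    have hβ : (schedule K S T)[b] = batch K S T b := by
      simp [batch, List.getElem?_eq_getElem hb]
    rw [h, Finset.sum_range_add, ih (by omega), List.take_succ_eq_append_getElem hb, cost_append,
      zero_add, ← grid_eq_rounds, hβ]
    simp only [cost, add_zero, batchCost]
    congr 1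
    refine Finset.sum_congr rfl fun τ hτ => ?_
    have hτ' := Finset.mem_range.1 hτ
    rw [action_eq, batchIndex_eq hb (by omega) (by omega), runState_within_batch δ x hb hm hτ']
    simp

lemma sum_action_eq_cost (hg : StrictGrid χ T) (hT : mainRounds K T ≤ T) (u : Unit) :
    ∑ t ∈ Finset.range T, g ((algorithm χ T δ V).action u x t) =
      cost χ T δ x g (schedule K S T) 0 (initState K S V) := by
  have h := sum_action_grid (V := V) δ x g hg u le_rfl
  rwa [grid_length χ hT, List.take_length] at h

end Execution

end BlockScan

namespace BlockScan

/-! ### Regret on tables with accurate empirical means -/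

section Deterministic

variable {K S : ℕ} {V : Register}

/-- The register after the first `n` entries of `y` have been added. -/
def regFold (V : Register) (y : ℕ → ℝ) : ℕ → V.Carrier
  | 0 => V.zero
  | n + 1 => V.add (regFold V y n) (y n)

/-- All empirical means over at most `T` consecutive rounds, as computed by the registers, are
accurate estimates of `μ`, and the confidence radii are ordered. -/
structure GoodTable (V : Register) (T : ℕ) (δ : ℝ) (x : ℕ → Fin K → ℝ) (μ : Fin K → ℝ)
    (best : Fin K) : Prop where
  le_best : ∀ a, μ a ≤ μ best
  gap_le_one : ∀ a, μ best - μ a ≤ 1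
  one_le_len : ∀ i, 1 ≤ len K T i
  one_le_radius : 1 ≤ radius δ (len K T 0)
  radius_anti : ∀ i k, i ≤ k → k ≤ numOuter K T → radius δ (len K T k) ≤ radius δ (len K T i)
  estimate : ∀ a s n, 1 ≤ n → s + n ≤ T →
    |V.val (regFold V (fun t => x (s + t) a) n) / n - μ a| ≤ radius δ n

/-- A Hoare triple with a bound on the total gap of the arms that are pulled. -/
def Triple (χ : Choices K S) (T : ℕ) (δ : ℝ) (x : ℕ → Fin K → ℝ) (g : Fin K → ℝ)
    (P Q : State K S V → Prop) (l : List Batch) (C : ℝ) : Prop :=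
  ∀ s m, s + rounds χ T l ≤ T → P m → Q (exec χ T δ x l s m) ∧ cost χ T δ x g l s m ≤ C

variable {χ : Choices K S} {T : ℕ} {δ : ℝ} {x : ℕ → Fin K → ℝ} {g : Fin K → ℝ}

lemma Triple.append {P Q R : State K S V → Prop} {l l' : List Batch} {C C' : ℝ}
    (h : Triple χ T δ x g P Q l C) (h' : Triple χ T δ x g Q R l' C') :
    Triple χ T δ x g P R (l ++ l') (C + C') := by
  intro s m hs hP
  rw [rounds_append] at hs
  obtain ⟨h1, h2⟩ := h s m (by omega) hP
  obtain ⟨h3, h4⟩ := h' (s + rounds χ T l) _ (by omega) h1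
  rw [exec_append, cost_append]
  exact ⟨h3, add_le_add h2 h4⟩

lemma Triple.flatMap_range {P : ℕ → State K S V → Prop} {f : ℕ → List Batch} {C : ℕ → ℝ} {n : ℕ}
    (h : ∀ i < n, Triple χ T δ x g (P i) (P (i + 1)) (f i) (C i)) :
    Triple χ T δ x g (P 0) (P n) ((List.range n).flatMap f) (∑ i ∈ Finset.range n, C i) := by
  induction n with
  | zero => intro s m _ hP; simpa [exec, cost] using hP
  | succ n ih =>
    rw [List.range_succ, List.flatMap_append, Finset.sum_range_succ]
    refine (ih fun i hi => h i (by omega)).append ?_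
    simpa using h n (by omega)

lemma Triple.consequence {P P' Q Q' : State K S V → Prop} {l : List Batch} {C C' : ℝ}
    (h : Triple χ T δ x g P Q l C) (hP : ∀ m, P' m → P m) (hQ : ∀ m, Q m → Q' m) (hC : C ≤ C') :
    Triple χ T δ x g P' Q' l C' := fun s m hs hm =>
  ⟨hQ _ (h s m hs (hP m hm)).1, (h s m hs (hP m hm)).2.trans hC⟩

lemma Triple.singleton {P Q : State K S V → Prop} {β : Batch} {C : ℝ}
    (hQ : ∀ s m, s + batchLen χ T β ≤ T → P m → Q (batchStep χ T δ x s m β))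
    (hg : ∀ m, P m → ∀ τ < batchLen χ T β, g (pull χ T τ (startBatch m β) β) ≤ C) :
    Triple χ T δ x g P Q [β] (batchLen χ T β * C) := by
  intro s m hs hm
  refine ⟨hQ s m (by simpa using hs) hm, ?_⟩
  simp only [cost, add_zero, batchCost]
  refine (Finset.sum_le_card_nsmul _ _ C fun τ hτ => hg m hm τ (Finset.mem_range.1 hτ)).trans ?_
  simp

/-! ### Closed forms for the memory inside a batch -/

lemma batchFold_refresh (s : ℕ) (m : State K S V) (i τ : ℕ) :
    batchFold χ T x s m (.refresh i) τ =
      { m with init := m.inc, incSum := regFold V (fun t => x (s + t) m.inc) τ } := by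
  induction τ with
  | zero => rfl
  | succ τ ih =>
    rw [batchFold, ih]
    rfl

/-- The activity flags during the slot at level `k`. -/
def slotActive (k : ℕ) (m : State K S V) : Fin S → Bool := if k = 1 then fun _ => true else m.active

open Classical in
-- Position `q` owns the rounds `[q t_k, (q + 1) t_k)` of the slot, so its register has received
-- `min t_k (τ - q t_k)` rewards, with truncated subtraction giving `0` before its turn. The rewards
-- come from one window of consecutive rounds of one arm, which is the form covered by
-- `GoodTable.estimate`.
lemma batchFold_slot (hlen : ∀ i, 1 ≤ len K T i) (s : ℕ) (m : State K S V) (i j k τ : ℕ) :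
    batchFold χ T x s m (.slot i j k) τ =
      { m with
        active := slotActive k m
        sum := fun q => if slotActive k m q = true then
            regFold V (fun t => x (s + q.val * len K T k + t) (χ.order i m.init (χ.cut i j + q.val)))
              (min (len K T k) (τ - q.val * len K T k))
          else V.zero } := by
  induction τ with
  | zero => simp [batchFold, startBatch, slotActive, regFold]
  | succ τ ih =>
    rw [batchFold, ih]
    simp only [record, startBatch, pull, isActiveAt]
    congr 1
    funext q
    have hl := hlen k
    change (if q.val = τ / len K T k ∧ slotActive k m q = true then _ else _) = _
    by_cases hq : slotActive k m q = true
    · by_cases hτ : q.val = τ / len K T k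
      · have hex : ∃ q' : Fin S, q'.val = q.val ∧
            (if k = 1 then fun _ => true else m.active) q' = true := ⟨q, rfl, hq⟩
        simp only [hq, if_true, ← hτ, true_and, hex]
        have h1 : q.val * len K T k ≤ τ := by rw [hτ]; exact Nat.div_mul_le_self _ _
        have h2 : τ < q.val * len K T k + len K T k := by
          rw [hτ]; exact Nat.lt_div_mul_add hl
        have h3 : min (len K T k) (τ + 1 - q.val * len K T k) =
            min (len K T k) (τ - q.val * len K T k) + 1 := by omega
        have h4 : s + q.val * len K T k + min (len K T k) (τ - q.val * len K T k) = s + τ := by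
          omega
        rw [h3, regFold, h4]
      · simp only [hq, hτ, false_and, if_false, if_true]
        congr 1
        rcases lt_or_gt_of_ne hτ with h | h
        · have : (q.val + 1) * len K T k ≤ τ := by
            rw [← Nat.le_div_iff_mul_le hl]; omega
          rw [add_mul, one_mul] at this
          omega
        · rw [Nat.div_lt_iff_lt_mul hl] at h
          omega
    · simp [hq]

/-! ### Invariants of the block scan -/

variable {μ : Fin K → ℝ} {best : Fin K}

/-- The facts about the incumbent that hold before block `j` of outer iteration `i`. -/
structure BlockInv (χ : Choices K S) (T : ℕ) (δ : ℝ) (μ : Fin K → ℝ) (best : Fin K) (i j : ℕ)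
    (m : State K S V) : Prop where
  inc_est : |incMean T i m - μ m.inc| ≤ radius δ (len K T i)
  inc_gap : μ best - μ m.inc ≤ 4 * radius δ (len K T (i - 1))
  pending : μ best - μ m.inc ≤ 4 * radius δ (len K T i) ∨
    best ≠ m.init ∧ ∀ p < χ.cut i j, χ.order i m.init p ≠ best

/-- The facts about the active arms that hold after level `k` in block `j` of outer
iteration `i`. -/
structure SlotInv (χ : Choices K S) (T : ℕ) (δ : ℝ) (μ : Fin K → ℝ) (best : Fin K) (i j k : ℕ)
    (m : State K S V) : Prop where
  toBlockInv : BlockInv χ T δ μ best i j m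
  slot_est : 1 ≤ k → ∀ q : Fin S, χ.cut i j + q.val < χ.cut i (j + 1) → m.active q = true →
    |slotMean T k m q - μ (χ.order i m.init (χ.cut i j + q.val))| ≤ radius δ (len K T k)
  survivor : 1 ≤ k → ∀ q : Fin S, χ.cut i j + q.val < χ.cut i (j + 1) → m.active q = true →
    μ m.inc - 4 * radius δ (len K T k) ≤ μ (χ.order i m.init (χ.cut i j + q.val))
  best_active : 1 ≤ k → ∀ q : Fin S, χ.cut i j + q.val < χ.cut i (j + 1) →
    χ.order i m.init (χ.cut i j + q.val) = best → m.active q = true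

/-- A survivor is within `4 c(t_k)` of the incumbent, which is within `4 c(t_{i-1}) ≤ 4 c(t_k)` of
the best arm. At `k = 0` nothing has been tested, and the bound holds because gaps are at most `1 ≤
c(t_0)`. -/
lemma SlotInv.slotActive_gap (hx : GoodTable V T δ x μ best) {i j k : ℕ} {m : State K S V}
    (h : SlotInv χ T δ μ best i j k m) (hk : k < i) (hi : i ≤ numOuter K T) {q : Fin S}
    (hq : χ.cut i j + q.val < χ.cut i (j + 1)) (ha : slotActive (k + 1) m q = true) :
    μ best - μ (χ.order i m.init (χ.cut i j + q.val)) ≤ 8 * radius δ (len K T k) := by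
  rcases Nat.eq_zero_or_pos k with rfl | hk0
  · have := hx.gap_le_one (χ.order i m.init (χ.cut i j + q.val))
    have := hx.one_le_radius
    linarith
  · have ha' : m.active q = true := by simpa [slotActive, hk0.ne'] using ha
    have h1 := h.survivor hk0 q hq ha'
    have h2 := h.toBlockInv.inc_gap
    have h3 := hx.radius_anti k (i - 1) (by omega) (by omega)
    linarith

lemma SlotInv.slotActive_best {i j k : ℕ} {m : State K S V}
    (h : SlotInv χ T δ μ best i j k m) {q : Fin S}
    (hq : χ.cut i j + q.val < χ.cut i (j + 1))
    (hb : χ.order i m.init (χ.cut i j + q.val) = best) : slotActive (k + 1) m q = true := by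
  rcases Nat.eq_zero_or_pos k with rfl | hk0
  · simp [slotActive]
  · simpa [slotActive, hk0.ne'] using h.best_active hk0 q hq hb

/-- The test threshold is `2 c(t_{k+1})`, while the arm estimate errs by `c(t_{k+1})` and the
benchmark by `c(t_i) ≤ c(t_{k+1})`. The two errors together cannot push the best arm below the
threshold, and a survivor loses at most threshold plus errors, that is `4 c(t_{k+1})`. -/
lemma SlotInv.step (hx : GoodTable V T δ x μ best) {i j k s : ℕ} {m : State K S V}
    (h : SlotInv χ T δ μ best i j k m) (hk : k < i) (hi : i ≤ numOuter K T)
    (hs : s + batchLen χ T (.slot i j (k + 1)) ≤ T) :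
    SlotInv χ T δ μ best i j (k + 1) (deactivate T δ i (k + 1)
      (batchFold χ T x s m (.slot i j (k + 1)) (batchLen χ T (.slot i j (k + 1))))) := by
  have hl := hx.one_le_len (k + 1)
  have hrad := hx.radius_anti (k + 1) i hk hi
  have hinc := abs_le.1 h.toBlockInv.inc_est
  rw [batchFold_slot hx.one_le_len]
  simp only [batchLen] at hs ⊢
  set ℓ := len K T (k + 1) with hℓ
  set m' : State K S V := { m with
        active := slotActive (k + 1) m
        sum := fun q => if slotActive (k + 1) m q = true then
            regFold V (fun t => x (s + q.val * ℓ + t) (χ.order i m.init (χ.cut i j + q.val)))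
              (min ℓ ((χ.cut i (j + 1) - χ.cut i j) * ℓ - q.val * ℓ))
          else V.zero } with hm'
  have hincM : incMean T i m' = incMean T i m := rfl
  have hest : ∀ q : Fin S, χ.cut i j + q.val < χ.cut i (j + 1) → slotActive (k + 1) m q = true →
      |slotMean T (k + 1) m' q - μ (χ.order i m.init (χ.cut i j + q.val))| ≤ radius δ ℓ := by
    intro q hq ha
    have h1 : q.val * ℓ + ℓ ≤ (χ.cut i (j + 1) - χ.cut i j) * ℓ := by
      rw [← Nat.succ_mul]
      exact Nat.mul_le_mul_right _ (by omega)
    -- At the end of the slot every position inside the block has its full `ℓ` rewards.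
    have h2 : min ℓ ((χ.cut i (j + 1) - χ.cut i j) * ℓ - q.val * ℓ) = ℓ := by omega
    have h3 := hx.estimate (χ.order i m.init (χ.cut i j + q.val)) (s + q.val * ℓ) ℓ hl (by omega)
    simpa only [slotMean, hm', ha, if_true, h2] using h3
  have hact : ∀ q, (deactivate T δ i (k + 1) m').active q = true ↔ slotActive (k + 1) m q = true ∧
      incMean T i m - 2 * radius δ ℓ ≤ slotMean T (k + 1) m' q := by
    intro q
    simp only [deactivate, Bool.and_eq_true, Bool.not_eq_true', decide_eq_false_iff_not, not_lt]
    rfl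
  refine ⟨⟨h.toBlockInv.inc_est, h.toBlockInv.inc_gap, h.toBlockInv.pending⟩, ?_, ?_, ?_⟩
  · intro _ q hq ha
    exact hest q hq ((hact q).1 ha).1
  · intro _ q hq ha
    have h1 := abs_le.1 (hest q hq ((hact q).1 ha).1)
    have h2 := ((hact q).1 ha).2
    change μ m.inc - 4 * radius δ ℓ ≤ μ (χ.order i m.init (χ.cut i j + q.val))
    linarith [h1.1, h1.2, hinc.1, hinc.2]
  · intro _ q hq hb
    replace hb : χ.order i m.init (χ.cut i j + q.val) = best := hb
    have ha := h.slotActive_best hq hb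
    refine (hact q).2 ⟨ha, ?_⟩
    have h1 := abs_le.1 (hest q hq ha)
    rw [hb] at h1
    have h2 := hx.le_best m.inc
    linarith [h1.1, h1.2, hinc.1, hinc.2]

lemma tie_mem_bestArms (χ : Choices K S) (T i j : ℕ) (m : State K S V)
    (h : (activeArms χ i j m).Nonempty) :
    χ.tie i j m.init (bestArms χ T i j m) ∈ bestArms χ T i j m := by
  refine χ.tie_mem i j m.init _ ?_
  obtain ⟨q, hq, hmax⟩ := Finset.exists_max_image _ (slotMean T i m) h
  exact ⟨q, Finset.mem_filter.2 ⟨hq, hmax⟩⟩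

lemma mem_activeArms {i j : ℕ} {m : State K S V} {q : Fin S} :
    q ∈ activeArms χ i j m ↔ χ.cut i j + q.val < χ.cut i (j + 1) ∧ m.active q = true := by
  simp [activeArms]

/-- The margin `2 c(t_i)` exceeds both estimation errors, so replacement never lowers the true mean
and the gap bounds persist. If the best arm lies in this block, a replacement has mean at least `μ
best - 2 c(t_i)`, and no replacement means that `μ best` exceeds the incumbent's mean by at most `4
c(t_i)`. -/
lemma SlotInv.replaceIncumbent {i j : ℕ} {m : State K S V}
    (h : SlotInv χ T δ μ best i j i m) (hi : 1 ≤ i) :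
    BlockInv χ T δ μ best i (j + 1) (replaceIncumbent χ T δ i j m) := by
  have hinc := abs_le.1 h.toBlockInv.inc_est
  have hgap := h.toBlockInv.inc_gap
  -- Three cases: the incumbent is already good enough, the best arm is still ahead, or it is in
  -- this block, has survived, and has a large empirical mean.
  have hpend : μ best - μ m.inc ≤ 4 * radius δ (len K T i) ∨
      (best ≠ m.init ∧ ∀ p < χ.cut i (j + 1), χ.order i m.init p ≠ best) ∨
      ∃ q ∈ activeArms χ i j m, μ best - radius δ (len K T i) ≤ slotMean T i m q := by
    rcases h.toBlockInv.pending with h1 | ⟨h1, h2⟩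
    · exact Or.inl h1
    right
    by_cases h3 : ∀ p < χ.cut i (j + 1), χ.order i m.init p ≠ best
    · exact Or.inl ⟨h1, h3⟩
    right
    push Not at h3
    obtain ⟨p, hp, hpb⟩ := h3
    have h4 : χ.cut i j ≤ p := by
      by_contra hc
      exact h2 p (not_le.1 hc) hpb
    have h5 := χ.cut_size i j
    have h6 : χ.cut i j + (p - χ.cut i j) = p := by omega
    refine ⟨⟨p - χ.cut i j, by omega⟩, ?_, ?_⟩
    · exact mem_activeArms.2 ⟨by simpa [h6] using hp,
        h.best_active hi _ (by simpa [h6] using hp) (by simpa [h6] using hpb)⟩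
    · have h7 := abs_le.1 (h.slot_est hi ⟨p - χ.cut i j, by omega⟩ (by simpa [h6] using hp)
        (h.best_active hi _ (by simpa [h6] using hp) (by simpa [h6] using hpb)))
      simp only [h6, hpb] at h7
      linarith [h7.1]
  have htie := tie_mem_bestArms χ T i j m
  unfold BlockScan.replaceIncumbent
  set q := χ.tie i j m.init (bestArms χ T i j m)
  have hmax : ∀ q' ∈ activeArms χ i j m, slotMean T i m q' ≤ slotMean T i m q := fun q' hq' =>
    (Finset.mem_filter.1 (htie ⟨q', hq'⟩)).2 q' hq'
  by_cases hrep : (activeArms χ i j m).Nonempty ∧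
      incMean T i m + 2 * radius δ (len K T i) ≤ slotMean T i m q
  · simp only [hrep, and_self, if_true]
    obtain ⟨hne, hle⟩ := hrep
    have hq := mem_activeArms.1 (Finset.mem_filter.1 (htie hne)).1
    have hest := h.slot_est hi q hq.1 hq.2
    have hest' := abs_le.1 hest
    refine ⟨hest, ?_, ?_⟩
    · change μ best - μ (χ.order i m.init (χ.cut i j + q.val)) ≤ _
      linarith [hest'.1, hest'.2, hinc.1, hinc.2]
    · change μ best - μ (χ.order i m.init (χ.cut i j + q.val)) ≤ _ ∨ _
      rcases hpend with h1 | h1 | ⟨q', hq', h1⟩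
      · left
        linarith [hest'.1, hest'.2, hinc.1, hinc.2]
      · exact Or.inr h1
      · left
        have := hmax q' hq'
        have h0 : 0 ≤ radius δ (len K T i) := Real.sqrt_nonneg _
        linarith [hest'.1, hest'.2, hinc.1, hinc.2]
  · simp only [hrep, if_false]
    refine ⟨h.toBlockInv.inc_est, hgap, ?_⟩
    rcases hpend with h1 | h1 | ⟨q', hq', h1⟩
    · exact Or.inl h1
    · exact Or.inr h1
    · left
      have h2 := hmax q' hq'
      have h3 : slotMean T i m q < incMean T i m + 2 * radius δ (len K T i) := by
        by_contra hc
        exact hrep ⟨⟨q', hq'⟩, not_lt.1 hc⟩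
      linarith [hinc.1, hinc.2]

/-! ### Cost of slots, blocks and outer iterations -/

variable (χ)

/-- The total gap in a slot: a bound for each block position. -/
lemma triple_slot (hx : GoodTable V T δ x μ best) {i j k : ℕ} (hk : k < i) (hi : i ≤ numOuter K T)
    {Q : State K S V → Prop}
    (hQ : ∀ s m, s + batchLen χ T (.slot i j (k + 1)) ≤ T → SlotInv χ T δ μ best i j k m →
      Q (batchStep χ T δ x s m (.slot i j (k + 1)))) :
    Triple (V := V) χ T δ x (fun a => μ best - μ a) (SlotInv χ T δ μ best i j k) Q
      [.slot i j (k + 1)] (batchLen χ T (.slot i j (k + 1)) * (8 * radius δ (len K T k))) := by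
  refine Triple.singleton hQ ?_
  intro m hm τ hτ
  simp only [pull]
  split_ifs with hact
  · obtain ⟨q, hq, ha⟩ := hact
    rw [← hq]
    refine hm.slotActive_gap hx hk hi ?_ ha
    have hl := hx.one_le_len (k + 1)
    have : τ / len K T (k + 1) < χ.cut i (j + 1) - χ.cut i j := by
      rw [Nat.div_lt_iff_lt_mul hl]; exact hτ
    omega
  -- Rounds reserved for a deactivated arm go to the benchmark, whose gap `4 c(t_{i-1})` is within
  -- the same budget because `k ≤ i - 1`.
  · have h1 := hm.toBlockInv.inc_gap
    have h2 := hx.radius_anti k (i - 1) (by omega) (by omega)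
    have h0 : 0 ≤ radius δ (len K T k) := Real.sqrt_nonneg _
    change μ best - μ m.inc ≤ _
    linarith

variable {D : ℝ} (hD : ∀ k < numOuter K T, (len K T (k + 1) : ℝ) * (8 * radius δ (len K T k)) ≤ D)

include hD in
lemma slot_cost_le {i j k : ℕ} (hk : k < numOuter K T) :
    (batchLen χ T (.slot i j (k + 1)) : ℝ) * (8 * radius δ (len K T k)) ≤
      ((χ.cut i (j + 1) - χ.cut i j : ℕ) : ℝ) * D := by
  rw [batchLen]
  push_cast
  rw [mul_assoc]
  exact mul_le_mul_of_nonneg_left (hD k hk) (by positivity)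

include hD in
-- The last level is split off because it alone ends with the incumbent update, turning the slot
-- invariant into the block invariant for `j + 1`.
lemma triple_blockSlots (hx : GoodTable V T δ x μ best) {i j : ℕ} (hi : i < numOuter K T) :
    Triple (V := V) χ T δ x (fun a => μ best - μ a) (BlockInv χ T δ μ best (i + 1) j)
      (BlockInv χ T δ μ best (i + 1) (j + 1)) (blockSlots i j)
      ((i + 1) * (((χ.cut (i + 1) (j + 1) - χ.cut (i + 1) j : ℕ) : ℝ) * D)) := by
  have hlist : blockSlots i j = (List.range i).flatMap (fun k => [Batch.slot (i + 1) j (k + 1)]) ++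
      [Batch.slot (i + 1) j (i + 1)] := by
    rw [blockSlots, List.range_succ, List.map_append, List.map_eq_flatMap]
    rfl
  rw [hlist]
  have h1 : Triple (V := V) χ T δ x (fun a => μ best - μ a) (SlotInv χ T δ μ best (i + 1) j 0)
      (SlotInv χ T δ μ best (i + 1) j i)
      ((List.range i).flatMap (fun k => [Batch.slot (i + 1) j (k + 1)]))
      (∑ _k ∈ Finset.range i, ((χ.cut (i + 1) (j + 1) - χ.cut (i + 1) j : ℕ) : ℝ) * D) := by
    refine Triple.flatMap_range fun k hk => ?_
    refine (triple_slot χ hx (by omega) (by omega) ?_).consequence (fun _ h => h) (fun _ h => h)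
      (slot_cost_le χ hD (by omega))
    intro s m hs hm
    have h2 : ¬ k + 1 = i + 1 := by omega
    have h3 := hm.step hx (show k < i + 1 by omega) (by omega) hs
    simpa only [batchStep, finishBatch, h2, if_false] using h3
  have h2 : Triple (V := V) χ T δ x (fun a => μ best - μ a) (SlotInv χ T δ μ best (i + 1) j i)
      (BlockInv χ T δ μ best (i + 1) (j + 1)) [Batch.slot (i + 1) j (i + 1)]
      (((χ.cut (i + 1) (j + 1) - χ.cut (i + 1) j : ℕ) : ℝ) * D) := by
    refine (triple_slot χ hx (by omega) (by omega) ?_).consequence (fun _ h => h) (fun _ h => h)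
      (slot_cost_le χ hD (by omega))
    intro s m hs hm
    have h3 := (hm.step hx (show i < i + 1 by omega) (by omega) hs).replaceIncumbent (by omega)
    simpa only [batchStep, finishBatch, if_true] using h3
  refine (h1.append h2).consequence ?_ (fun _ h => h) ?_
  · intro m hm
    exact ⟨hm, by omega, by omega, by omega⟩
  · rw [Finset.sum_const, Finset.card_range, nsmul_eq_mul]
    linarith

/-- After the last block the alternative "best arm still ahead" is impossible, since the ordering
exhausts all arms other than the initial incumbent. -/
lemma BlockInv.inc_gap_of_last {i : ℕ} {m : State K S V}
    (h : BlockInv χ T δ μ best i (numBlocks K S) m) :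
    μ best - μ m.inc ≤ 4 * radius δ (len K T i) := by
  rcases h.pending with h1 | ⟨h1, h2⟩
  · exact h1
  · obtain ⟨p, hp, hpb⟩ := (χ.order_bij i m.init).surjOn h1
    rw [χ.cut_last] at h2
    exact absurd hpb (h2 p hp)

lemma blockInv_refresh (hx : GoodTable V T δ x μ best) {i s : ℕ} {m : State K S V}
    (h : μ best - μ m.inc ≤ 4 * radius δ (len K T i))
    (hs : s + batchLen χ T (.refresh (i + 1)) ≤ T) :
    BlockInv χ T δ μ best (i + 1) 0 (batchStep χ T δ x s m (.refresh (i + 1))) := by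
  rw [batchStep, batchFold_refresh]
  simp only [finishBatch, batchLen] at hs ⊢
  refine ⟨hx.estimate m.inc s _ (hx.one_le_len _) hs, h, ?_⟩
  by_cases hb : best = m.inc
  · left
    have h0 : 0 ≤ radius δ (len K T (i + 1)) := Real.sqrt_nonneg _
    change μ best - μ m.inc ≤ _
    rw [hb]
    linarith
  · right
    refine ⟨hb, fun p hp => ?_⟩
    rw [χ.cut_zero] at hp
    omega

include hD in
lemma triple_outerBatches (hK : 2 ≤ K) (hx : GoodTable V T δ x μ best) {i : ℕ}
    (hi : i < numOuter K T) (hD0 : 0 ≤ D) :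
    Triple (V := V) χ T δ x (fun a => μ best - μ a)
      (fun m => μ best - μ m.inc ≤ 4 * radius δ (len K T i))
      (fun m => μ best - μ m.inc ≤ 4 * radius δ (len K T (i + 1))) (outerBatches K S i)
      (K * numOuter K T * D) := by
  have h1 : Triple (V := V) χ T δ x (fun a => μ best - μ a)
      (fun m => μ best - μ m.inc ≤ 4 * radius δ (len K T i))
      (BlockInv χ T δ μ best (i + 1) 0) [Batch.refresh (i + 1)]
      (batchLen χ T (.refresh (i + 1)) * (8 * radius δ (len K T i))) := by
    refine Triple.singleton (fun s m hs hm => blockInv_refresh χ hx hm hs) fun m hm τ _ => ?_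
    have h0 : 0 ≤ radius δ (len K T i) := Real.sqrt_nonneg _
    change μ best - μ m.inc ≤ _
    linarith
  have h2 := Triple.flatMap_range (P := BlockInv χ T δ μ best (i + 1)) (n := numBlocks K S)
    fun j _ => triple_blockSlots χ hD hx (j := j) hi
  refine (h1.append h2).consequence (fun _ h => h) (fun m hm => hm.inc_gap_of_last χ) ?_
  rw [← Finset.mul_sum, ← Finset.sum_mul, ← Nat.cast_sum, sum_block_sizes,
    Nat.cast_sub (by omega)]
  have h3 := hD i hi
  have h4 : (i : ℝ) + 1 ≤ numOuter K T := by exact_mod_cast hi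
  have hK' : (2 : ℝ) ≤ K := by exact_mod_cast hK
  have h5 : ((i : ℝ) + 1) * (((K : ℝ) - 1) * D) ≤ numOuter K T * (((K : ℝ) - 1) * D) :=
    mul_le_mul_of_nonneg_right h4 (mul_nonneg (by linarith) hD0)
  have h6 : D ≤ numOuter K T * D := by
    have : (0 : ℝ) ≤ i := by positivity
    nlinarith
  simp only [batchLen, Nat.cast_one]
  nlinarith

include hD in
-- The loop invariant is that the incumbent entering outer iteration `i + 1` has gap at most `4
-- c(t_i)`; it holds for any starting arm because `c(t_0) ≥ 1`. The bound `D` on a single position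
-- in a single slot is the same at all levels.
lemma cost_schedule_le (hK : 2 ≤ K) (hx : GoodTable V T δ x μ best) (hD0 : 0 ≤ D)
    (hT : mainRounds K T ≤ T) (m : State K S V) :
    cost χ T δ x (fun a => μ best - μ a) (schedule K S T) 0 m ≤
      K * numOuter K T ^ 2 * D + T * (4 * radius δ (len K T (numOuter K T))) := by
  have h1 := Triple.flatMap_range
    (P := fun i (m : State K S V) => μ best - μ m.inc ≤ 4 * radius δ (len K T i))
    (n := numOuter K T) fun i hi => triple_outerBatches χ hD hK hx hi hD0
  have h2 : Triple (V := V) χ T δ x (fun a => μ best - μ a)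
      (fun m => μ best - μ m.inc ≤ 4 * radius δ (len K T (numOuter K T))) (fun _ => True)
      [Batch.final] (batchLen χ T .final * (4 * radius δ (len K T (numOuter K T)))) :=
    Triple.singleton (fun _ _ _ _ => trivial) fun m hm _ _ => hm
  have h3 := ((h1.append h2) 0 m (by rw [← schedule_eq, rounds_schedule χ hT, zero_add]) ?_).2
  · rw [← schedule_eq] at h3
    refine h3.trans (add_le_add (le_of_eq ?_) ?_)
    · rw [Finset.sum_const, Finset.card_range, nsmul_eq_mul]
      ring
    · refine mul_le_mul_of_nonneg_right ?_ (mul_nonneg (by norm_num) (Real.sqrt_nonneg _))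
      exact_mod_cast Nat.sub_le _ _
  · have := hx.gap_le_one m.inc
    have := hx.one_le_radius
    linarith

end Deterministic

end BlockScan

/-! ### Measurability -/

/-- The operations of the register are measurable. -/
structure Register.IsMeasurable (V : Register) : Prop where
  measurable_add : Measurable fun z : V.Carrier × ℝ => V.add z.1 z.2
  measurable_val : Measurable V.val

/-- Used to evaluate at a random index: the reward of the pulled arm, and the mean and sum of the
selected position. -/
lemma measurable_apply_discrete {α ι β : Type*} [MeasurableSpace α] [MeasurableSpace β]
    [Countable ι] [MeasurableSpace ι] [MeasurableSingletonClass ι] {f : α → ι → β} {g : α → ι}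
    (hf : ∀ i, Measurable fun z => f z i) (hg : Measurable g) : Measurable fun z => f z (g z) := by
  have h : Measurable fun z : α × ι => f z.1 z.2 := measurable_from_prod_countable_left hf
  exact h.comp (measurable_id.prodMk hg)

namespace BatchedAlg

variable {K : ℕ} {A : BatchedAlg K} {T : ℕ}

lemma IsStaticGrid.measurable_run (h : A.IsStaticGrid T) (t : ℕ) :
    Measurable fun ω : A.Seed × (ℕ → Fin K → ℝ) => A.run ω.1 ω.2 t := by
  induction t with
  | zero => exact measurable_const
  | succ t ih =>
    have ha : Measurable fun ω : A.Seed × (ℕ → Fin K → ℝ) =>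
        A.plan (A.batchAt t) t (A.run ω.1 ω.2 t).1 ω.1 :=
      (h.measurable_plan (A.batchAt t) t).comp (ih.fst.prodMk measurable_fst)
    have hr : Measurable fun ω : A.Seed × (ℕ → Fin K → ℝ) =>
        ω.2 t (A.plan (A.batchAt t) t (A.run ω.1 ω.2 t).1 ω.1) :=
      measurable_apply_discrete (f := fun ω : A.Seed × (ℕ → Fin K → ℝ) => ω.2 t)
        (fun a => by fun_prop) ha
    have hm := (h.measurable_update t).comp
      (ih.snd.prodMk (measurable_fst.prodMk (ha.prodMk hr)))
    simp only [run]
    split_ifs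
    · exact hm.prodMk hm
    · exact ih.fst.prodMk hm

lemma IsStaticGrid.measurable_action (h : A.IsStaticGrid T) (t : ℕ) :
    Measurable fun ω : A.Seed × (ℕ → Fin K → ℝ) => A.action ω.1 ω.2 t :=
  (h.measurable_plan (A.batchAt t) t).comp ((h.measurable_run t).fst.prodMk measurable_fst)

lemma IsStaticGrid.measurable_regret (h : A.IsStaticGrid T) (ν : BanditInstance K) :
    Measurable (A.regret T ν) := by
  unfold regret
  refine Finset.measurable_sum _ fun t _ => ?_
  exact (Measurable.of_discrete (f := fun a => ν.best - ν.mean a)).comp (h.measurable_action t)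

end BatchedAlg

/-! ### Measurability of the maps of the algorithm -/

namespace BlockScan

section StateMeasurability

variable {K S : ℕ} {V : Register} {α : Type*} [MeasurableSpace α]

lemma measurable_toProd : Measurable (State.toProd : State K S V → _) := comap_measurable _

lemma measurable_state_mk {a b : α → Fin K} {c : α → V.Carrier} {d : α → Fin S → Bool}
    {e : α → Fin S → V.Carrier} (ha : Measurable a) (hb : Measurable b) (hc : Measurable c)
    (hd : Measurable d) (he : Measurable e) :
    Measurable fun z => State.mk (a z) (b z) (c z) (d z) (e z) :=
  measurable_comap_iff.2 (ha.prodMk (hb.prodMk (hc.prodMk (hd.prodMk he))))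

lemma measurable_init : Measurable (State.init : State K S V → _) := measurable_toProd.fst

lemma measurable_inc : Measurable (State.inc : State K S V → _) := measurable_toProd.snd.fst

lemma measurable_incSum : Measurable (State.incSum : State K S V → _) :=
  measurable_toProd.snd.snd.fst

lemma measurable_active : Measurable (State.active : State K S V → _) :=
  measurable_toProd.snd.snd.snd.fst

lemma measurable_sum : Measurable (State.sum : State K S V → _) :=
  measurable_toProd.snd.snd.snd.snd

lemma measurable_active_apply (q : Fin S) : Measurable fun m : State K S V => m.active q :=
  (measurable_pi_apply q).comp measurable_active

lemma measurable_sum_apply (q : Fin S) : Measurable fun m : State K S V => m.sum q :=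
  (measurable_pi_apply q).comp measurable_sum

lemma measurableSet_active (q : Fin S) : MeasurableSet {m : State K S V | m.active q = true} :=
  measurable_active_apply q (measurableSet_singleton true)

lemma measurable_startBatch (β : Batch) :
    Measurable fun m : State K S V => startBatch m β := by
  cases β with
  | refresh i =>
    exact measurable_state_mk measurable_inc measurable_inc measurable_const measurable_active
      measurable_sum
  | slot i j k =>
    refine measurable_state_mk measurable_init measurable_inc measurable_incSum ?_
      measurable_const
    split_ifs
    · exact measurable_const
    · exact measurable_active
  | final => exact measurable_id

lemma measurable_pull (χ : Choices K S) (T τ : ℕ) (β : Batch) :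
    Measurable fun m : State K S V => pull χ T τ m β := by
  cases β with
  | refresh i => exact measurable_inc
  | slot i j k =>
    refine Measurable.ite ?_ ?_ measurable_inc
    · have : {m : State K S V | isActiveAt T k τ m} =
          ⋃ q : Fin S, {m | q.val = τ / len K T k ∧ m.active q = true} := by
        ext m; simp [isActiveAt]
      rw [this]
      refine MeasurableSet.iUnion fun q => ?_
      exact (MeasurableSet.const _).inter (measurableSet_active q)
    · exact (Measurable.of_discrete
        (f := fun a => χ.order i a (χ.cut i j + τ / len K T k))).comp measurable_init
  | final => exact measurable_inc

variable (hV : V.IsMeasurable)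

include hV

lemma measurable_record (T τ : ℕ) (β : Batch) :
    Measurable fun z : State K S V × ℝ => record T τ z.2 z.1 β := by
  cases β with
  | refresh i =>
    exact measurable_state_mk (measurable_init.comp measurable_fst)
      (measurable_inc.comp measurable_fst)
      (hV.measurable_add.comp ((measurable_incSum.comp measurable_fst).prodMk measurable_snd))
      (measurable_active.comp measurable_fst) (measurable_sum.comp measurable_fst)
  | slot i j k =>
    refine measurable_state_mk (measurable_init.comp measurable_fst)
      (measurable_inc.comp measurable_fst) (measurable_incSum.comp measurable_fst)
      (measurable_active.comp measurable_fst) (measurable_pi_lambda _ fun q => ?_)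
    refine Measurable.ite ?_ ?_ ((measurable_sum_apply q).comp measurable_fst)
    · exact (MeasurableSet.const _).inter (measurable_fst (measurableSet_active q))
    · exact hV.measurable_add.comp
        (((measurable_sum_apply q).comp measurable_fst).prodMk measurable_snd)
  | final => exact measurable_fst

lemma measurable_slotMean (T k : ℕ) (q : Fin S) :
    Measurable fun m : State K S V => slotMean T k m q :=
  (hV.measurable_val.comp (measurable_sum_apply q)).div_const _

lemma measurable_incMean (T i : ℕ) : Measurable fun m : State K S V => incMean T i m :=
  (hV.measurable_val.comp measurable_incSum).div_const _

lemma measurable_deactivate (T : ℕ) (δ : ℝ) (i k : ℕ) :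
    Measurable fun m : State K S V => deactivate T δ i k m := by
  refine measurable_state_mk measurable_init measurable_inc measurable_incSum
    (measurable_pi_lambda _ fun q => ?_) measurable_sum
  refine measurable_to_bool ?_
  have : (fun m : State K S V => m.active q &&
      !decide (slotMean T k m q < incMean T i m - 2 * radius δ (len K T k))) ⁻¹' {true} =
      {m | m.active q = true} ∩
        {m | slotMean T k m q < incMean T i m - 2 * radius δ (len K T k)}ᶜ := by
    ext m
    simp
  convert (measurableSet_active q).inter
    (measurableSet_lt (measurable_slotMean hV T k q)
      ((measurable_incMean hV T i).sub_const (2 * radius δ (len K T k)))).compl using 1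

omit hV in
lemma measurableSet_mem_activeArms (χ : Choices K S) (i j : ℕ) (q : Fin S) :
    MeasurableSet {m : State K S V | q ∈ activeArms χ i j m} := by
  simp only [mem_activeArms]
  exact (MeasurableSet.const _).inter (measurableSet_active q)

lemma measurableSet_mem_bestArms (χ : Choices K S) (T i j : ℕ) (q : Fin S) :
    MeasurableSet {m : State K S V | q ∈ bestArms χ T i j m} := by
  have : {m : State K S V | q ∈ bestArms χ T i j m} = {m | q ∈ activeArms χ i j m} ∩
      ⋂ q', ({m | q' ∈ activeArms χ i j m}ᶜ ∪ {m | slotMean T i m q' ≤ slotMean T i m q}) := by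
    ext m
    simp [bestArms, imp_iff_not_or]
  rw [this]
  refine (measurableSet_mem_activeArms χ i j q).inter (MeasurableSet.iInter fun q' => ?_)
  exact (measurableSet_mem_activeArms χ i j q').compl.union
    (measurableSet_le (measurable_slotMean hV T i q') (measurable_slotMean hV T i q))

lemma measurable_tie (χ : Choices K S) (T i j : ℕ) :
    Measurable fun m : State K S V => χ.tie i j m.init (bestArms χ T i j m) := by
  let _ : MeasurableSpace (Finset (Fin S)) := ⊤
  have h : Measurable fun m : State K S V => bestArms χ T i j m := by
    refine measurable_to_countable' fun s => ?_
    have : (fun m : State K S V => bestArms χ T i j m) ⁻¹' {s} =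
        ⋂ q, {m | q ∈ bestArms χ T i j m ↔ q ∈ s} := by
      ext m
      simp [Finset.ext_iff]
    rw [this]
    refine MeasurableSet.iInter fun q => ?_
    by_cases hq : q ∈ s
    · simp only [hq, iff_true]
      exact measurableSet_mem_bestArms hV χ T i j q
    · simp only [hq, iff_false]
      exact (measurableSet_mem_bestArms hV χ T i j q).compl
  exact (Measurable.of_discrete (f := fun z : Fin K × Finset (Fin S) => χ.tie i j z.1 z.2)).comp
    (measurable_init.prodMk h)

lemma measurable_replaceIncumbent (χ : Choices K S) (T : ℕ) (δ : ℝ) (i j : ℕ) :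
    Measurable fun m : State K S V => replaceIncumbent χ T δ i j m := by
  have hq := measurable_tie hV χ T i j
  refine Measurable.ite ?_ ?_ measurable_id
  · refine MeasurableSet.inter ?_ ?_
    · have : {m : State K S V | (activeArms χ i j m).Nonempty} =
          ⋃ q, {m | q ∈ activeArms χ i j m} := by
        ext m; simp [Finset.Nonempty]
      change MeasurableSet {m : State K S V | (activeArms χ i j m).Nonempty}
      rw [this]
      exact MeasurableSet.iUnion fun q => measurableSet_mem_activeArms χ i j q
    · exact measurableSet_le ((measurable_incMean hV T i).add_const _)
        (measurable_apply_discrete (fun q => measurable_slotMean hV T i q) hq)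
  · refine measurable_state_mk measurable_init ?_ ?_ measurable_active measurable_sum
    · exact (Measurable.of_discrete
        (f := fun z : Fin K × Fin S => χ.order i z.1 (χ.cut i j + z.2.val))).comp
        (measurable_init.prodMk hq)
    · exact measurable_apply_discrete (fun q => measurable_sum_apply q) hq

lemma measurable_finishBatch (χ : Choices K S) (T : ℕ) (δ : ℝ) (β : Batch) :
    Measurable fun m : State K S V => finishBatch χ T δ m β := by
  cases β with
  | refresh i => exact measurable_id
  | slot i j k =>
    simp only [finishBatch]
    split_ifs
    · exact (measurable_replaceIncumbent hV χ T δ i j).comp (measurable_deactivate hV T δ i k)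
    · exact measurable_deactivate hV T δ i k
  | final => exact measurable_id

lemma algorithm_isStaticGrid [NeZero K] {χ : Choices K S} {T : ℕ} (δ : ℝ) (hg : StrictGrid χ T)
    (hT : mainRounds K T ≤ T) : (algorithm χ T δ V).IsStaticGrid T where
  seed_prob := inferInstanceAs (IsProbabilityMeasure (Measure.dirac ()))
  grid_zero := BlockScan.grid_zero (T := T) χ
  grid_lt := hg
  grid_last := grid_length χ hT
  measurable_plan b t :=
    (measurable_pull χ T _ _).comp ((measurable_startBatch _).comp measurable_fst)
  measurable_update t := by
    change Measurable fun z : State K S V × Unit × Fin K × ℝ =>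
      let b := batchIndex χ T t
      let β := batch K S T b
      let m₁ := if t = grid χ T b then startBatch z.1 β else z.1
      let m₂ := record T (t - grid χ T b) z.2.2.2 m₁ β
      if t + 1 = grid χ T (b + 1) then finishBatch χ T δ m₂ β else m₂
    have h1 : Measurable fun z : State K S V × Unit × Fin K × ℝ =>
        if t = grid χ T (batchIndex χ T t) then
          startBatch z.1 (batch K S T (batchIndex χ T t)) else z.1 := by
      split_ifs
      · exact (measurable_startBatch _).comp measurable_fst
      · exact measurable_fst
    have h2 := (measurable_record hV T (t - grid χ T (batchIndex χ T t))
      (batch K S T (batchIndex χ T t))).comp (h1.prodMk measurable_snd.snd.snd)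
    by_cases h3 : t + 1 = grid χ T (batchIndex χ T t + 1)
    · simp only [h3, if_true]
      exact (measurable_finishBatch hV χ T δ _).comp h2
    · simp only [h3, if_false]
      exact h2

end StateMeasurability

end BlockScan

/-! ### Concentration and expected regret -/

namespace BanditInstance

variable {K : ℕ} (ν : BanditInstance K)

instance : IsProbabilityMeasure ν.tableLaw :=
  inferInstanceAs (IsProbabilityMeasure (Measure.infinitePi fun _ : ℕ => Measure.pi ν.law))

lemma integrable_id (a : Fin K) : Integrable (fun x => x) (ν.law a) :=
  Integrable.of_mem_Icc 0 1 measurable_id.aemeasurable (ν.supp a)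

lemma mean_nonneg (a : Fin K) : 0 ≤ ν.mean a :=
  integral_nonneg_of_ae ((ν.supp a).mono fun _ hx => hx.1)

lemma mean_le_one (a : Fin K) : ν.mean a ≤ 1 := by
  have h := integral_mono_ae (ν.integrable_id a) (integrable_const (1 : ℝ))
    ((ν.supp a).mono fun _ hx => hx.2)
  rw [mean]
  simpa using h

lemma mean_le_best (a : Fin K) : ν.mean a ≤ ν.best :=
  le_ciSup (Set.finite_range ν.mean).bddAbove a

lemma exists_mean_eq_best [NeZero K] : ∃ a, ν.mean a = ν.best := exists_eq_ciSup_of_finite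

lemma gap_nonneg (a : Fin K) : 0 ≤ ν.best - ν.mean a := sub_nonneg.2 (ν.mean_le_best a)

lemma gap_le_one (a : Fin K) : ν.best - ν.mean a ≤ 1 := by
  have : NeZero K := ⟨fun h => by subst h; exact a.elim0⟩
  obtain ⟨b, hb⟩ := ν.exists_mean_eq_best
  linarith [ν.mean_le_one b, ν.mean_nonneg a]

lemma measurePreserving_table_eval (t : ℕ) (a : Fin K) :
    MeasurePreserving (fun x : ℕ → Fin K → ℝ => x t a) ν.tableLaw (ν.law a) :=
  (measurePreserving_eval ν.law a).comp
    (measurePreserving_eval_infinitePi (fun _ : ℕ => Measure.pi ν.law) t)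

lemma iIndepFun_table {f : ℝ → ℝ} (hf : Measurable f) (a : Fin K) (s : ℕ) :
    ProbabilityTheory.iIndepFun (fun (t : ℕ) (x : ℕ → Fin K → ℝ) => f (x (s + t) a))
      ν.tableLaw := by
  have h := ProbabilityTheory.iIndepFun_infinitePi (P := fun _ : ℕ => Measure.pi ν.law)
    (X := fun (_ : ℕ) (r : Fin K → ℝ) => f (r a)) (fun _ => by fun_prop)
  exact h.precomp (g := fun t => s + t) (add_right_injective s)

lemma hasSubgaussianMGF_table {f : ℝ → ℝ} (hf : Measurable f)
    (hf01 : ∀ y ∈ Set.Icc (0 : ℝ) 1, f y ∈ Set.Icc (0 : ℝ) 1) (a : Fin K) (t : ℕ) :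
    ProbabilityTheory.HasSubgaussianMGF
      (fun x : ℕ → Fin K → ℝ => f (x t a) - ∫ y, f y ∂(ν.law a)) (1 / 4) ν.tableLaw := by
  have hmp := ν.measurePreserving_table_eval t a
  have h := ProbabilityTheory.hasSubgaussianMGF_of_mem_Icc (μ := ν.tableLaw) (a := 0) (b := 1)
    (X := fun x : ℕ → Fin K → ℝ => f (x t a)) (hf.comp hmp.measurable).aemeasurable
    (hmp.quasiMeasurePreserving.ae ((ν.supp a).mono fun y hy => hf01 y hy))
  have hmean : ∫ x : ℕ → Fin K → ℝ, f (x t a) ∂ν.tableLaw = ∫ y, f y ∂(ν.law a) := by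
    rw [← hmp.map_eq, integral_map hmp.measurable.aemeasurable hf.aestronglyMeasurable]
  rw [hmean] at h
  convert h using 1
  norm_num

lemma measure_deviation_le {f : ℝ → ℝ} (hf : Measurable f)
    (hf01 : ∀ y ∈ Set.Icc (0 : ℝ) 1, f y ∈ Set.Icc (0 : ℝ) 1) (a : Fin K) (s : ℕ) {n : ℕ}
    (hn : 1 ≤ n) {δ : ℝ} (hδ : 0 < δ) (hδ1 : δ ≤ 1) :
    ν.tableLaw.real {x | ¬ |(∑ t ∈ Finset.range n, f (x (s + t) a)) / n - ∫ y, f y ∂(ν.law a)| ≤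
      BlockScan.radius δ n} ≤ δ := by
  set m := ∫ y, f y ∂(ν.law a)
  have hn' : (0 : ℝ) < n := by exact_mod_cast hn
  have hL : 0 ≤ Real.log (2 / δ) := Real.log_nonneg (by rw [le_div_iff₀ hδ]; linarith)
  have hr : 0 ≤ BlockScan.radius δ n := Real.sqrt_nonneg _
  -- The radius solves `2 n c² = log (2 / δ)`, so each of the two tails has probability at most `δ /
  -- 2`.
  have hexp : Real.exp (-(n * BlockScan.radius δ n) ^ 2 / (2 * n * ((1 / 4 : NNReal) : ℝ))) =
      δ / 2 := by
    have : -(n * BlockScan.radius δ n) ^ 2 / (2 * n * ((1 / 4 : NNReal) : ℝ)) =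
        -Real.log (2 / δ) := by
      rw [mul_pow, BlockScan.radius, Real.sq_sqrt (by positivity)]
      push_cast
      field_simp
      ring
    rw [this, Real.exp_neg, Real.exp_log (by positivity), inv_div]
  have h1 := ProbabilityTheory.HasSubgaussianMGF.measure_sum_range_ge_le_of_iIndepFun
    (ν.iIndepFun_table (hf.sub_const m) a s) (n := n)
    (fun t _ => ν.hasSubgaussianMGF_table hf hf01 a (s + t))
    (ε := n * BlockScan.radius δ n) (by positivity)
  have h2 := ProbabilityTheory.HasSubgaussianMGF.measure_sum_range_ge_le_of_iIndepFun
    (ν.iIndepFun_table (hf.sub_const m).neg a s) (n := n)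
    (fun t _ => (ν.hasSubgaussianMGF_table hf hf01 a (s + t)).neg)
    (ε := n * BlockScan.radius δ n) (by positivity)
  rw [hexp] at h1 h2
  have h3 := (measureReal_union_le _ _).trans (add_le_add h1 h2)
  refine (measureReal_mono ?_ (measure_ne_top _ _)).trans (h3.trans (by linarith))
  intro x hx
  simp only [Set.mem_ofPred_eq, not_le] at hx
  have hsum : (∑ t ∈ Finset.range n, f (x (s + t) a)) =
      ∑ t ∈ Finset.range n, (f (x (s + t) a) - m) + n * m := by
    simp [Finset.sum_sub_distrib]
  have hdiv : (∑ t ∈ Finset.range n, f (x (s + t) a)) / n - m =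
      (∑ t ∈ Finset.range n, (f (x (s + t) a) - m)) / n := by
    rw [hsum]
    field_simp
    ring
  rw [hdiv, lt_abs, lt_div_iff₀ hn', ← neg_div, lt_div_iff₀ hn'] at hx
  rcases hx with hx | hx
  · left
    change n * BlockScan.radius δ n ≤ ∑ t ∈ Finset.range n, (f (x (s + t) a) - m)
    linarith
  · right
    change n * BlockScan.radius δ n ≤ ∑ t ∈ Finset.range n, -(f (x (s + t) a) - m)
    rw [Finset.sum_neg_distrib]
    linarith

/-- The tables on which some empirical mean over at most `T` consecutive rounds is inaccurate. -/
def badTables (f : ℝ → ℝ) (T : ℕ) (δ : ℝ) : Set (ℕ → Fin K → ℝ) :=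
  {x | ∃ a s n, 1 ≤ n ∧ s + n ≤ T ∧
    ¬ |(∑ t ∈ Finset.range n, f (x (s + t) a)) / n - ∫ y, f y ∂(ν.law a)| ≤
      BlockScan.radius δ n}

lemma measure_badTables_le {f : ℝ → ℝ} (hf : Measurable f)
    (hf01 : ∀ y ∈ Set.Icc (0 : ℝ) 1, f y ∈ Set.Icc (0 : ℝ) 1) (T : ℕ) {δ : ℝ} (hδ : 0 < δ)
    (hδ1 : δ ≤ 1) : ν.tableLaw.real (ν.badTables f T δ) ≤ K * T * T * δ := by
  have hsub : ν.badTables f T δ ⊆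
      ⋃ i ∈ (Finset.univ : Finset (Fin K)) ×ˢ Finset.range T ×ˢ Finset.Icc 1 T,
        {x | ¬ |(∑ t ∈ Finset.range i.2.2, f (x (i.2.1 + t) i.1)) / i.2.2 -
          ∫ y, f y ∂(ν.law i.1)| ≤ BlockScan.radius δ i.2.2} := by
    rintro x ⟨a, s, n, hn, hsn, hx⟩
    refine Set.mem_biUnion (x := (a, s, n)) ?_ hx
    simp
    omega
  refine (measureReal_mono hsub (measure_ne_top _ _)).trans ((measureReal_biUnion_finset_le _ _).trans ?_)
  refine (Finset.sum_le_card_nsmul _ _ δ ?_).trans ?_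
  · rintro ⟨a, s, n⟩ hi
    simp only [Finset.mem_product, Finset.mem_Icc] at hi
    exact ν.measure_deviation_le hf hf01 a s hi.2.2.1 hδ hδ1
  · simp [Finset.card_product, mul_assoc]

end BanditInstance

/-! ### From good tables to expected regret -/

namespace BatchedAlg

variable {K : ℕ} {A : BatchedAlg K} {T : ℕ}

lemma regret_nonneg (ν : BanditInstance K) (ω : A.Seed × (ℕ → Fin K → ℝ)) :
    0 ≤ A.regret T ν ω := Finset.sum_nonneg fun _ _ => ν.gap_nonneg _

lemma regret_le (ν : BanditInstance K) (ω : A.Seed × (ℕ → Fin K → ℝ)) :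
    A.regret T ν ω ≤ T := by
  refine (Finset.sum_le_card_nsmul _ _ 1 fun _ _ => ν.gap_le_one _).trans ?_
  simp

/-- On the bad set the regret is bounded by `T`. The set need not be measurable: it is replaced by
its measurable hull, which has the same measure. -/
lemma IsStaticGrid.integral_regret_le (h : A.IsStaticGrid T) (ν : BanditInstance K) {R ε : ℝ}
    (hR : 0 ≤ R) {B : Set (ℕ → Fin K → ℝ)} (hB : T * ν.tableLaw.real B ≤ ε)
    (hreg : ∀ u x, x ∉ B → A.regret T ν (u, x) ≤ R) :
    Integrable (A.regret T ν) (A.jointLaw ν) ∧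
      ∫ ω, A.regret T ν ω ∂(A.jointLaw ν) ≤ R + ε := by
  have := h.seed_prob
  have : IsProbabilityMeasure (A.jointLaw ν) :=
    inferInstanceAs (IsProbabilityMeasure (A.seedLaw.prod ν.tableLaw))
  have hint : Integrable (A.regret T ν) (A.jointLaw ν) :=
    Integrable.of_mem_Icc 0 T (h.measurable_regret ν).aemeasurable
      (Filter.Eventually.of_forall fun ω => ⟨regret_nonneg ν ω, regret_le ν ω⟩)
  refine ⟨hint, ?_⟩
  set B' := toMeasurable ν.tableLaw B
  have hB' : MeasurableSet B' := measurableSet_toMeasurable _ _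
  have hmp : MeasurePreserving Prod.snd (A.jointLaw ν) ν.tableLaw := measurePreserving_snd
  have hP : (A.jointLaw ν).real (Prod.snd ⁻¹' B') = ν.tableLaw.real B := by
    rw [Measure.real, hmp.measure_preimage hB'.nullMeasurableSet, measure_toMeasurable]
    rfl
  have hind : Integrable (fun ω : A.Seed × (ℕ → Fin K → ℝ) =>
      R + (Prod.snd ⁻¹' B').indicator (fun _ => (T : ℝ)) ω) (A.jointLaw ν) :=
    (integrable_const R).add ((integrable_const (T : ℝ)).indicator (hB'.preimage measurable_snd))
  have hle : ∀ ω, A.regret T ν ω ≤ R + (Prod.snd ⁻¹' B').indicator (fun _ => (T : ℝ)) ω := by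
    rintro ⟨u, x⟩
    by_cases hx : x ∈ B'
    · have h1 : (u, x) ∈ Prod.snd ⁻¹' B' := hx
      rw [Set.indicator_of_mem h1]
      linarith [regret_le (A := A) (T := T) ν (u, x)]
    · have h1 : (u, x) ∉ Prod.snd ⁻¹' B' := hx
      rw [Set.indicator_of_notMem h1, add_zero]
      exact hreg u x fun hc => hx (subset_toMeasurable _ _ hc)
  refine (integral_mono hint hind hle).trans ?_
  rw [integral_add (integrable_const R)
    ((integrable_const (T : ℝ)).indicator (hB'.preimage measurable_snd)),
    integral_indicator_const _ (hB'.preimage measurable_snd), hP]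
  simp only [integral_const, probReal_univ, smul_eq_mul, one_mul]
  linarith

end BatchedAlg

/-! ### Registers -/

/-- The register holds the sum of the values under `f` of up to `T` rewards, and `f` rounds
rewards down by at most `1 / T`. -/
structure Register.Stores (V : Register) (T : ℕ) (f : ℝ → ℝ) : Prop where
  isMeasurable : V.IsMeasurable
  val_regFold : ∀ (y : ℕ → ℝ) (n : ℕ), n ≤ T →
    V.val (BlockScan.regFold V y n) = ∑ t ∈ Finset.range n, f (y t)
  measurable : Measurable f
  mem_Icc : ∀ y ∈ Set.Icc (0 : ℝ) 1, f y ∈ Set.Icc (0 : ℝ) 1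
  apply_le : ∀ y ∈ Set.Icc (0 : ℝ) 1, f y ≤ y
  le_apply_add : ∀ y ∈ Set.Icc (0 : ℝ) 1, y ≤ f y + 1 / T

lemma Register.exact_stores (T : ℕ) : Register.exact.Stores T id where
  isMeasurable := by
    refine ⟨?_, measurable_id⟩
    change Measurable fun z : ℝ × ℝ => z.1 + z.2
    exact measurable_fst.add measurable_snd
  val_regFold y n _ := by
    change BlockScan.regFold Register.exact y n = _
    induction n with
    | zero => rfl
    | succ n ih =>
      rw [Finset.sum_range_succ, ← ih (by omega)]
      rfl
  measurable := measurable_id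
  mem_Icc _ hy := hy
  apply_le _ _ := le_rfl
  le_apply_add y _ := by
    have : (0 : ℝ) ≤ 1 / T := by positivity
    simp only [id]
    linarith

/-- The rounding of the finite precision register. -/
noncomputable def Register.roundDown (T p : ℕ) (y : ℝ) : ℝ :=
  (min ⌊(T : ℝ) ^ p * y⌋₊ (T ^ p) : ℕ) / (T : ℝ) ^ p

lemma Register.rounded_isMeasurable (T p : ℕ) : (Register.rounded T p).IsMeasurable := by
  have h1 : Countable (Register.rounded T p).Carrier :=
    inferInstanceAs (Countable (Fin (T ^ (p + 1) + 1)))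
  have h2 : DiscreteMeasurableSpace (Register.rounded T p).Carrier := ⟨fun _ => trivial⟩
  refine ⟨measurable_from_prod_countable_right fun v => ?_, Measurable.of_discrete⟩
  exact (Measurable.of_discrete (f := fun k : ℕ => (⟨min (Fin.val v + min k (T ^ p)) (T ^ (p + 1)),
    Nat.lt_succ_of_le (min_le_right _ _)⟩ : (Register.rounded T p).Carrier))).comp
    (Nat.measurable_floor.comp (measurable_const_mul ((T : ℝ) ^ p)))

/-- The cap `T ^ (p + 1)` is never active, since at most `T` summands of size at most `T ^ p` are
added. -/
lemma Register.rounded_val_regFold (T p : ℕ) (y : ℕ → ℝ) {n : ℕ} (hn : n ≤ T) :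
    Fin.val (n := T ^ (p + 1) + 1) (BlockScan.regFold (Register.rounded T p) y n) =
      ∑ t ∈ Finset.range n, min ⌊(T : ℝ) ^ p * y t⌋₊ (T ^ p) := by
  induction n with
  | zero => rfl
  | succ n ih =>
    have h1 : ∑ t ∈ Finset.range (n + 1), min ⌊(T : ℝ) ^ p * y t⌋₊ (T ^ p) ≤ T ^ (p + 1) := by
      refine (Finset.sum_le_card_nsmul _ _ (T ^ p) fun t _ => min_le_right _ _).trans ?_
      rw [Finset.card_range, smul_eq_mul, pow_succ, mul_comm]
      exact Nat.mul_le_mul_left _ hn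
    rw [Finset.sum_range_succ] at h1 ⊢
    rw [← ih (by omega)] at h1 ⊢
    exact min_eq_left h1

lemma Register.rounded_stores {T p : ℕ} (hT : 1 ≤ T) (hp : 1 ≤ p) :
    (Register.rounded T p).Stores T (Register.roundDown T p) := by
  have hT' : (1 : ℝ) ≤ T := by exact_mod_cast hT
  have hTp : (0 : ℝ) < (T : ℝ) ^ p := by positivity
  have hle : ∀ y ∈ Set.Icc (0 : ℝ) 1, roundDown T p y ≤ y := by
    intro y hy
    rw [roundDown, div_le_iff₀ hTp]
    have h1 : ((min ⌊(T : ℝ) ^ p * y⌋₊ (T ^ p) : ℕ) : ℝ) ≤ ⌊(T : ℝ) ^ p * y⌋₊ := by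
      exact_mod_cast min_le_left _ _
    have h2 := Nat.floor_le (mul_nonneg hTp.le hy.1)
    linarith
  refine ⟨rounded_isMeasurable T p, ?_, ?_, ?_, hle, ?_⟩
  · intro y n hn
    change (Fin.val (n := T ^ (p + 1) + 1)
      (BlockScan.regFold (Register.rounded T p) y n) : ℝ) / (T : ℝ) ^ p = _
    rw [rounded_val_regFold T p y hn]
    push_cast [roundDown]
    rw [Finset.sum_div]
  · refine Measurable.div_const ?_ _
    exact (Measurable.of_discrete (f := fun k : ℕ => ((min k (T ^ p) : ℕ) : ℝ))).comp
      (Nat.measurable_floor.comp (measurable_const_mul ((T : ℝ) ^ p)))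
  · intro y hy
    exact ⟨by unfold roundDown; positivity, (hle y hy).trans hy.2⟩
  · intro y hy
    have h1 : ⌊(T : ℝ) ^ p * y⌋₊ ≤ T ^ p := by
      refine Nat.floor_le_of_le ?_
      push_cast
      exact mul_le_of_le_one_right hTp.le hy.2
    have h2 := Nat.lt_floor_add_one ((T : ℝ) ^ p * y)
    have h3 : 1 / (T : ℝ) ^ p ≤ 1 / T :=
      one_div_le_one_div_of_le (by linarith) (le_self_pow₀ hT' (by omega))
    have h4 : y ≤ roundDown T p y + 1 / (T : ℝ) ^ p := by
      rw [roundDown, min_eq_left h1, ← add_div, le_div_iff₀ hTp]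
      linarith
    linarith

namespace BlockScan

/-! ### Batches, regret and memory of the algorithm -/

lemma log_two_div_zpow {T : ℕ} (hT : 1 ≤ T) :
    Real.log (2 / (T : ℝ) ^ (-4 : ℤ)) = Real.log 2 + 4 * Real.log T := by
  have hT' : (0 : ℝ) < T := by exact_mod_cast hT
  rw [Real.log_div (by norm_num) (by positivity), Real.log_zpow]
  push_cast
  ring

section Regret

variable {K S T : ℕ}

/-- The rounds per position of a slot, weighted with the accuracy of the level before. -/
lemma len_succ_mul_radius_le (hK : 1 ≤ K) (hT : 16 ≤ T) (hN : 1 ≤ (T : ℝ) / (10 * K)) (k : ℕ) :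
    (len K T (k + 1) : ℝ) * (8 * radius ((T : ℝ) ^ (-4 : ℤ)) (len K T k)) ≤
      8 * √(T * Real.log T / K) := by
  have hT' : (16 : ℝ) ≤ T := by exact_mod_cast hT
  have hK' : (1 : ℝ) ≤ K := by exact_mod_cast hK
  have hl : (1 : ℝ) ≤ len K T k := by exact_mod_cast one_le_len (by linarith) k
  have h1 := len_succ_le_two_mul_sqrt hN k
  have hlog : Real.log 2 ≤ Real.log T := Real.log_le_log (by norm_num) (by linarith)
  have hlog2 := Real.log_two_gt_d9
  have h0 : 0 ≤ radius ((T : ℝ) ^ (-4 : ℤ)) (len K T k) := Real.sqrt_nonneg _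
  have h2 : 2 * √((len K T k : ℝ) * ((T : ℝ) / (10 * K))) *
      radius ((T : ℝ) ^ (-4 : ℤ)) (len K T k) ≤ √(T * Real.log T / K) := by
    refine Real.le_sqrt_of_sq_le ?_
    rw [radius, log_two_div_zpow (by omega), mul_pow, mul_pow, Real.sq_sqrt (by positivity),
      Real.sq_sqrt (div_nonneg (by linarith) (by positivity))]
    -- The length `t_k` cancels here, which is why the cost is the same at every level.
    have h3 : (2 : ℝ) ^ 2 * ((len K T k : ℝ) * ((T : ℝ) / (10 * K))) *
        ((Real.log 2 + 4 * Real.log T) / (2 * len K T k)) =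
        T * ((Real.log 2 + 4 * Real.log T) / 5) / K := by
      field_simp
      norm_num
    rw [h3]
    gcongr
    linarith
  have h4 := mul_le_mul_of_nonneg_right h1 h0
  linarith

lemma radius_last_le (hK : 1 ≤ K) (hT : 16 ≤ T) (hN : 4 ≤ (T : ℝ) / (10 * K)) :
    T * (4 * radius ((T : ℝ) ^ (-4 : ℤ)) (len K T (numOuter K T))) ≤
      40 * √(K * T * Real.log T) := by
  have hT' : (16 : ℝ) ≤ T := by exact_mod_cast hT
  have hK' : (1 : ℝ) ≤ K := by exact_mod_cast hK
  have hl := div_four_le_len_numOuter hN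
  have hlog : Real.log 2 ≤ Real.log T := Real.log_le_log (by norm_num) (by linarith)
  have hlog2 := Real.log_two_gt_d9
  have h2 : T * radius ((T : ℝ) ^ (-4 : ℤ)) (len K T (numOuter K T)) ≤
      10 * √(K * T * Real.log T) := by
    refine abs_le_of_sq_le_sq' ?_ (by positivity) |>.2
    rw [radius, log_two_div_zpow (by omega), mul_pow, mul_pow,
      Real.sq_sqrt (by positivity), Real.sq_sqrt (by positivity)]
    have h3 : (Real.log 2 + 4 * Real.log T) / (2 * (len K T (numOuter K T) : ℝ)) ≤
        5 * Real.log T / (2 * ((T : ℝ) / (10 * K) / 4)) := by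
      gcongr
      linarith
    calc _ ≤ (T : ℝ) ^ 2 * (5 * Real.log T / (2 * ((T : ℝ) / (10 * K) / 4))) := by gcongr
      _ = _ := by field_simp; ring
  linarith

lemma radius_anti_of_le {δ : ℝ} (hδ : 0 ≤ Real.log (2 / δ)) {s s' : ℕ} (hs : 1 ≤ s) (h : s ≤ s') :
    radius δ s' ≤ radius δ s := by
  have hs' : (0 : ℝ) < s := by exact_mod_cast hs
  have h' : (s : ℝ) ≤ s' := by exact_mod_cast h
  unfold radius
  gcongr

variable {V : Register} {f : ℝ → ℝ}

lemma integrable_of_stores (hV : V.Stores T f) (ν : BanditInstance K) (a : Fin K) :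
    Integrable f (ν.law a) :=
  Integrable.of_mem_Icc 0 1 hV.measurable.aemeasurable ((ν.supp a).mono hV.mem_Icc)

lemma integral_le_mean (hV : V.Stores T f) (ν : BanditInstance K) (a : Fin K) :
    ∫ y, f y ∂(ν.law a) ≤ ν.mean a :=
  integral_mono_ae (integrable_of_stores hV ν a) (ν.integrable_id a)
    ((ν.supp a).mono hV.apply_le)

lemma mean_le_integral_add (hV : V.Stores T f) (ν : BanditInstance K) (a : Fin K) :
    ν.mean a ≤ ∫ y, f y ∂(ν.law a) + 1 / T := by
  have h := integral_mono_ae (ν.integrable_id a)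
    ((integrable_of_stores hV ν a).add (integrable_const (1 / (T : ℝ))))
    ((ν.supp a).mono hV.le_apply_add)
  refine h.trans (le_of_eq ?_)
  simp only [Pi.add_apply]
  rw [integral_add (integrable_of_stores hV ν a) (integrable_const _)]
  simp

lemma strictGrid (χ : Choices K S) (hK : 2 ≤ K) (hS : 1 ≤ S)
    (hN : 10000 ≤ (T : ℝ) / (10 * K)) : StrictGrid χ T := fun _ hb =>
  grid_lt_grid_succ χ hK hS (by linarith) (mainRounds_lt (by omega) hN) hb

/-- Tables without inaccurate empirical means are good. -/
lemma goodTable (hV : V.Stores T f) (hT : 16 ≤ T) (hN : 10000 ≤ (T : ℝ) / (10 * K))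
    (ν : BanditInstance K) {x : ℕ → Fin K → ℝ}
    (hx : x ∉ ν.badTables f T ((T : ℝ) ^ (-4 : ℤ))) {best : Fin K}
    (hbest : ∀ a, ∫ y, f y ∂(ν.law a) ≤ ∫ y, f y ∂(ν.law best)) :
    GoodTable V T ((T : ℝ) ^ (-4 : ℤ)) x (fun a => ∫ y, f y ∂(ν.law a)) best := by
  have hT' : (16 : ℝ) ≤ T := by exact_mod_cast hT
  have hlog : Real.log 2 ≤ Real.log T := Real.log_le_log (by norm_num) (by linarith)
  have hlog2 := Real.log_two_gt_d9
  have hΛ := log_two_div_zpow (show 1 ≤ T by omega)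
  have hlen := one_le_len (show 0 < (T : ℝ) / (10 * K) by linarith)
  refine ⟨hbest, fun a => ?_, hlen, ?_, ?_, ?_⟩
  · have h1 := (integral_le_mean hV ν best).trans (ν.mean_le_one best)
    have h2 : 0 ≤ ∫ y, f y ∂(ν.law a) :=
      integral_nonneg_of_ae ((ν.supp a).mono fun y hy => (hV.mem_Icc y hy).1)
    linarith
  · rw [radius, hΛ]
    refine Real.one_le_sqrt.2 ?_
    simp only [len]
    norm_num
    linarith
  · intro i k hik hk
    exact radius_anti_of_le (by rw [hΛ]; linarith) (hlen i) (len_mono hN hik hk)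
  · intro a s n hn hsn
    rw [hV.val_regFold _ _ (by omega)]
    by_contra hc
    exact hx ⟨a, s, n, hn, hsn, hc⟩

variable [NeZero K]

lemma regret_le_of_notMem_badTables (χ : Choices K S) (hV : V.Stores T f) (hK : 2 ≤ K)
    (hS : 1 ≤ S) (hT : 16 ≤ T) (hN : 10000 ≤ (T : ℝ) / (10 * K)) (ν : BanditInstance K)
    (u : Unit) {x : ℕ → Fin K → ℝ} (hx : x ∉ ν.badTables f T ((T : ℝ) ^ (-4 : ℤ))) :
    (algorithm χ T ((T : ℝ) ^ (-4 : ℤ)) V).regret T ν (u, x) ≤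
      (8 * numOuter K T ^ 2 + 40) * √(K * T * Real.log T) + 1 := by
  have hT' : (16 : ℝ) ≤ T := by exact_mod_cast hT
  have hK' : (2 : ℝ) ≤ K := by exact_mod_cast hK
  obtain ⟨best, hbest⟩ := Finite.exists_max fun a => ∫ y, f y ∂(ν.law a)
  obtain ⟨a₀, ha₀⟩ := ν.exists_mean_eq_best
  -- Rounding down can only lower a mean, and by at most `1 / T`; so only the best arm's side loses,
  -- and the total over `T` rounds is `1`.
  have hgap : ∀ a, ν.best - ν.mean a ≤
      (∫ y, f y ∂(ν.law best) - ∫ y, f y ∂(ν.law a)) + 1 / T := by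
    intro a
    have h1 := mean_le_integral_add hV ν a₀
    have h2 := hbest a₀
    have h3 := integral_le_mean hV ν a
    linarith
  have hmain := (mainRounds_lt (by omega) hN).le
  have hcost := cost_schedule_le χ
    (fun k _ => len_succ_mul_radius_le (by omega) hT (by linarith) k) hK
    (goodTable hV hT hN ν hx hbest) (by positivity) hmain (initState K S V)
  rw [← sum_action_eq_cost _ x _ (strictGrid χ hK hS hN) hmain u] at hcost
  have hlast := radius_last_le (by omega) hT (show 4 ≤ (T : ℝ) / (10 * K) by linarith)
  have hsqrt : (K : ℝ) * √(T * Real.log T / K) = √(K * T * Real.log T) := by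
    have hlogT : 0 ≤ Real.log T := Real.log_nonneg (by linarith)
    rw [show (K : ℝ) * T * Real.log T = (K : ℝ) ^ 2 * (T * Real.log T / K) by field_simp,
      Real.sqrt_mul (by positivity), Real.sqrt_sq (by positivity)]
  have hreg : (algorithm χ T ((T : ℝ) ^ (-4 : ℤ)) V).regret T ν (u, x) ≤
      ∑ t ∈ Finset.range T, ((∫ y, f y ∂(ν.law best) -
        ∫ y, f y ∂(ν.law ((algorithm χ T ((T : ℝ) ^ (-4 : ℤ)) V).action u x t))) + 1 / T) :=
    Finset.sum_le_sum fun t _ => hgap _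
  rw [Finset.sum_add_distrib] at hreg
  have hone : ∑ _t ∈ Finset.range T, (1 : ℝ) / T = 1 := by
    rw [Finset.sum_const, Finset.card_range, nsmul_eq_mul]
    field_simp
  have : (K : ℝ) * (numOuter K T : ℝ) ^ 2 * (8 * √(T * Real.log T / K)) =
      8 * (numOuter K T : ℝ) ^ 2 * √(K * T * Real.log T) := by
    rw [← hsqrt]; ring
  linarith

lemma algorithm_achieves (χ : Choices K S) (hV : V.Stores T f) (hK : 2 ≤ K)
    (hS : 1 ≤ S) (hSK : S ≤ K) (hKT : 100000 * (K : ℝ) ≤ T) :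
    (algorithm χ T ((T : ℝ) ^ (-4 : ℤ)) V).Achieves T
      (54 * (K / S) * Real.log (Real.log T) ^ 2)
      (114 * √(K * T * Real.log T) * Real.log (Real.log T) ^ 2) := by
  have hK' : (2 : ℝ) ≤ K := by exact_mod_cast hK
  have hT' : (16 : ℝ) ≤ T := by linarith
  have hT : 16 ≤ T := by exact_mod_cast hT'
  have hN : 10000 ≤ (T : ℝ) / (10 * K) := by
    rw [le_div_iff₀ (by positivity)]; linarith
  have hmain := (mainRounds_lt (by omega) hN).le
  have hgrid := algorithm_isStaticGrid hV.isMeasurable ((T : ℝ) ^ (-4 : ℤ))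
    (strictGrid χ hK hS hN) hmain
  have hll := one_le_log_log hT
  have hL := numOuter_le (K := K) (by omega) (by linarith) hT
  have hL2 : (numOuter K T : ℝ) ^ 2 ≤ 9 * Real.log (Real.log T) ^ 2 := by
    have := pow_le_pow_left₀ (by positivity) hL 2
    nlinarith
  refine ⟨hgrid, ?_, fun ν => ?_⟩
  · have h1 : (((schedule K S T).length : ℕ) : ℝ) ≤
        3 * numBlocks K S * (numOuter K T : ℝ) ^ 2 := by
      exact_mod_cast length_schedule_le hK hS (one_le_numOuter (by linarith))
    have h2 := numBlocks_le hK hS hSK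
    change (((schedule K S T).length : ℕ) : ℝ) ≤ _
    calc _ ≤ 3 * (numBlocks K S : ℝ) * (numOuter K T : ℝ) ^ 2 := h1
      _ ≤ 3 * (2 * ((K : ℝ) / S)) * (9 * Real.log (Real.log T) ^ 2) := by gcongr
      _ = _ := by ring
  · have hδ : (0 : ℝ) < (T : ℝ) ^ (-4 : ℤ) := by positivity
    have hδ1 : (T : ℝ) ^ (-4 : ℤ) ≤ 1 := zpow_le_one_of_nonpos₀ (by linarith) (by norm_num)
    have hbad := ν.measure_badTables_le hV.measurable hV.mem_Icc T hδ hδ1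
    have hbad' : T * ν.tableLaw.real (ν.badTables f T ((T : ℝ) ^ (-4 : ℤ))) ≤ 1 := by
      calc _ ≤ (T : ℝ) * (K * T * T * (T : ℝ) ^ (-4 : ℤ)) := by gcongr
        _ = K / T := by
          rw [show (-4 : ℤ) = -((4 : ℕ) : ℤ) by norm_num, zpow_neg, zpow_natCast]
          field_simp
        _ ≤ 1 := by
          rw [div_le_one (by linarith)]
          linarith
    have hlogT : 1 ≤ Real.log T := by
      by_contra hc
      have h1 : Real.log (Real.log T) ≤ 0 :=
        Real.log_nonpos (Real.log_nonneg (by linarith)) (by linarith)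
      linarith
    have hQ : 1 ≤ √(K * T * Real.log T) := by
      refine Real.one_le_sqrt.2 ?_
      have : 1 ≤ (K : ℝ) * T := by nlinarith
      nlinarith
    obtain ⟨hint, hle⟩ := hgrid.integral_regret_le ν
      (R := (8 * numOuter K T ^ 2 + 40) * √(K * T * Real.log T) + 1) (by positivity) hbad'
      fun u x hx => regret_le_of_notMem_badTables χ hV hK hS hT hN ν u hx
    refine ⟨hint, hle.trans ?_⟩
    have hll2 : 1 ≤ Real.log (Real.log T) ^ 2 := one_le_pow₀ hll
    set Q := √(K * T * Real.log T)
    -- The `42` is `40` plus one for rounding and one for the bad event, both absorbed by `Q ≥ 1`;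
    -- then `114 = 8 * 9 + 42`.
    have h3 : (8 * (numOuter K T : ℝ) ^ 2 + 42) * Q ≤ (114 * Real.log (Real.log T) ^ 2) * Q := by
      gcongr
      linarith
    linarith

end Regret

section Memory

variable {K S : ℕ} {V : Register}

/-- A state is the tuple of its registers. -/
def State.equivProd : State K S V ≃
    Fin K × Fin K × V.Carrier × (Fin S → Bool) × (Fin S → V.Carrier) where
  toFun := State.toProd
  invFun z := ⟨z.1, z.2.1, z.2.2.1, z.2.2.2.1, z.2.2.2.2⟩
  left_inv _ := rfl
  right_inv _ := rfl

lemma algorithm_usesBits [NeZero K] (χ : Choices K S) {T p : ℕ} (δ : ℝ) (hS : 1 ≤ S)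
    (hKT : K ≤ T) (hT : 16 ≤ T) (hp : 1 ≤ p) :
    ∃ W : ℕ, (algorithm χ T δ (Register.rounded T p)).UsesBits W ∧
      (W : ℝ) ≤ 27 * p * S * Real.log T := by
  have hT' : (16 : ℝ) ≤ T := by exact_mod_cast hT
  have hlog2 := Real.log_two_gt_d9
  have hlog : 4 * Real.log 2 ≤ Real.log T := by
    have : Real.log 16 = 4 * Real.log 2 := by
      rw [show (16 : ℝ) = 2 ^ 4 by norm_num, Real.log_pow]; norm_num
    rw [← this]
    exact Real.log_le_log (by norm_num) hT'
  set w := ⌈Real.logb 2 T⌉₊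
  have hw : T ≤ 2 ^ w := by
    have h1 : (T : ℝ) ≤ 2 ^ w := by
      rw [← Real.rpow_natCast, ← Real.logb_le_iff_le_rpow (by norm_num) (by linarith)]
      exact Nat.le_ceil _
    exact_mod_cast h1
  have hw1 : (w : ℝ) ≤ 3 * Real.log T := by
    have h1 : (w : ℝ) < Real.logb 2 T + 1 :=
      Nat.ceil_lt_add_one (Real.logb_nonneg (by norm_num) (by linarith))
    have h2 : Real.logb 2 T ≤ 2 * Real.log T := by
      rw [Real.logb, div_le_iff₀ (by linarith)]
      nlinarith
    linarith
  have hw0 : 1 ≤ w := by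
    by_contra hc
    have : w = 0 := by omega
    rw [this] at hw
    omega
  have hR : T ^ (p + 1) + 1 ≤ 2 ^ (w * (p + 2)) := by
    rw [pow_mul]
    refine le_trans ?_ (Nat.pow_le_pow_left hw (p + 2))
    rw [pow_succ T (p + 1)]
    have : 1 ≤ T ^ (p + 1) := Nat.one_le_pow _ _ (by omega)
    nlinarith
  refine ⟨w + (w + (w * (p + 2) + (S + w * (p + 2) * S))), ⟨?_, ?_⟩, ?_⟩
  · have : Finite (Register.rounded T p).Carrier :=
      inferInstanceAs (Finite (Fin (T ^ (p + 1) + 1)))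
    exact Finite.of_equiv _ (State.equivProd (K := K) (S := S) (V := Register.rounded T p)).symm
  · have hc : Nat.card (Register.rounded T p).Carrier = T ^ (p + 1) + 1 :=
      Nat.card_fin _
    change Nat.card (State K S (Register.rounded T p)) ≤ _
    rw [Nat.card_congr State.equivProd]
    have hB : Nat.card (Fin S → Bool) = 2 ^ S := by simp
    have hKw : K ≤ 2 ^ w := hKT.trans hw
    rw [Nat.card_prod, Nat.card_prod, Nat.card_prod, Nat.card_prod, hB, Nat.card_fun, hc,
      Nat.card_fin, Nat.card_fin, pow_add 2 w, pow_add 2 w, pow_add 2 (w * (p + 2)),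
      pow_add 2 S, pow_mul 2 (w * (p + 2)) S]
    exact Nat.mul_le_mul hKw (Nat.mul_le_mul hKw (Nat.mul_le_mul hR
      (Nat.mul_le_mul le_rfl (Nat.pow_le_pow_left hR S))))
  · have hpw : (1 : ℝ) ≤ p := by exact_mod_cast hp
    have hS' : (1 : ℝ) ≤ S := by exact_mod_cast hS
    have hw0' : (1 : ℝ) ≤ w := by exact_mod_cast hw0
    have hpS : (1 : ℝ) ≤ p * S := by nlinarith
    have hS2 : (S : ℝ) ≤ p * S := by nlinarith
    have hp2 : (p : ℝ) ≤ p * S := by nlinarith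
    push_cast
    -- In units of `w p S`: two arm names, the summary, the flags and the sums take at most `2 + 3 +
    -- 1 + 3 = 9`, using `p + 2 ≤ 3 p`.
    have h1 : (w : ℝ) + (w + (w * (p + 2) + (S + w * (p + 2) * S))) ≤ w * (9 * (p * S)) := by
      nlinarith
    have h2 : (w : ℝ) * (9 * (p * S)) ≤ 3 * Real.log T * (9 * (p * S)) := by gcongr
    linarith

end Memory

end BlockScan

theorem mainTheorem2 :
    ∃ c C₁ C₂ C₃ : ℝ, 0 < c ∧ 0 < C₁ ∧ 0 < C₂ ∧ 0 < C₃ ∧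
      ∀ (K S T : ℕ) [NeZero K] (χ : BlockScan.Choices K S),
        2 ≤ K → 1 ≤ S → S ≤ K → c * K ≤ T →
          (BlockScan.algorithm χ T ((T : ℝ) ^ (-4 : ℤ)) Register.exact).Achieves T
              (C₂ * (K / S) * Real.log (Real.log T) ^ 2)
              (C₃ * √(K * T * Real.log T) * Real.log (Real.log T) ^ 2) ∧
          ∀ p : ℕ, 1 ≤ p →
            (BlockScan.algorithm χ T ((T : ℝ) ^ (-4 : ℤ)) (Register.rounded T p)).Achieves T
              (C₂ * (K / S) * Real.log (Real.log T) ^ 2)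
              (C₃ * √(K * T * Real.log T) * Real.log (Real.log T) ^ 2) ∧
            ∃ W : ℕ,
              (BlockScan.algorithm χ T ((T : ℝ) ^ (-4 : ℤ)) (Register.rounded T p)).UsesBits W ∧
              (W : ℝ) ≤ C₁ * p * S * Real.log T := by
  -- `T ≥ 100000 K` is exactly `N ≥ 10000`.
  refine ⟨100000, 27, 54, 114, by norm_num, by norm_num, by norm_num, by norm_num, ?_⟩
  intro K S T _ χ hK hS hSK hKT
  have hK' : (2 : ℝ) ≤ K := by exact_mod_cast hK
  have hT : 16 ≤ T := by
    have : (16 : ℝ) ≤ T := by linarith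
    exact_mod_cast this
  have hKT' : K ≤ T := by
    have : (K : ℝ) ≤ T := by linarith
    exact_mod_cast this
  refine ⟨BlockScan.algorithm_achieves χ (Register.exact_stores T) hK hS hSK hKT, fun p hp => ?_⟩
  exact ⟨BlockScan.algorithm_achieves χ (Register.rounded_stores (by omega) hp) hK hS hSK hKT,
    BlockScan.algorithm_usesBits χ _ hS hKT' hT hp⟩
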